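/- Let $n\in\mathbb N_0$ and $0<\hbar\le 1$. For $k\in\hbar\mathbb Z^n$ let $|k|$ be the Euclidean norm, $v_1,\dots,v_n$ the standard basis of $\mathbb Z^n$, and $\mathbb T^n=\mathbb R^n/\mathbb Z^n$ with normalised measure. Put $\Delta_{\hbar,j}g(k)=\hbar^{-1}\big(g(k+\hbar v_j)-g(k)\big)$, $\Delta_{\hbar,k}^\alpha=\Delta_{\hbar,1}^{\alpha_1}\cdots\Delta_{\hbar,n}^{\alpha_n}$ and $$D_{\hbar,\theta}^{(\beta)}=\hbar^{|\beta|}\prod_{j=1}^n\prod_{\ell=0}^{\beta_j-1}\Big(\frac1{2\pi i}\frac{\partial}{\partial\theta_j}-\ell\Big).$$ For $\mu,\rho,\delta\in\mathbb R$, $S^\mu_{\rho,\delta}(\hbar\mathbb Z^n\times\mathbb T^n)$ is the set of functions $\sigma:\hbar\mathbb Z^n\times\mathbb T^n\to\mathbb C$ with $\sigma(k,\cdot)\in C^\infty(\mathbb T^n)$ for all $k$ and such that for all $\alpha,\beta\in\mathbb N_0^n$ there is $C_{\alpha,\beta}>0$ with $$|D_{\hbar,\theta}^{(\beta)}\Delta_{\hbar,k}^\alpha\sigma(k,\theta)|\le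 C_{\alpha,\beta}(1+|k|)^{\mu-\rho|\alpha|+\delta|\beta|}\qquad\text{for all }k\in\hbar\mathbb Z^n,\ \theta\in\mathbb T^n.$$ For $f\in\ell^2(\hbar\mathbb Z^n)$ let $\widehat f(\theta)=\sum_{k}e^{-2\pi\frac i\hbar k\cdot\theta}f(k)$ (convergence in $L^2(\mathbb T^n)$) and $$\mathrm{Op}(\sigma)f(k)=\int_{\mathbb T^n}e^{2\pi\frac i\hbar k\cdot\theta}\sigma(k,\theta)\widehat f(\theta)\,d\theta,\qquad k\in\hbar\mathbb Z^n.$$ Let $\mathcal S(\hbar\mathbb Z^n)$ be the space of functions $f$ on $\hbar\mathbb Z^n$ with $|f(k)|\le C_N(1+|k|)^{-N}$ for every $N\in\mathbb N_0$. **Theorem (adjoint of a $\Psi_\hbar$DO).** Let $0\le\delta<\rho\le1$, $\mu\in\mathbb R$ and $\sigma\in S^\mu_{\rho,\delta}(\hbar\mathbb Z^n\times\mathbb T^n)$. Then there is a symbol $\sigma^*\in S^\mu_{\rho,\delta}(\hbar\mathbb Z^n\times\mathbb T^n)$ such that $\mathrm{Op}(\sigma)^*=\mathrm{Op}(\sigma^*)$,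 in the following sense. The space $\mathcal S(\hbar\mathbb Z^n)$ is dense in $\ell^2(\hbar\mathbb Z^n)$, and $\mathrm{Op}(\sigma)$ and $\mathrm{Op}(\sigma^*)$ map it into $\ell^2(\hbar\mathbb Z^n)$; the Hilbert space adjoint in $\ell^2(\hbar\mathbb Z^n)$ of $\mathrm{Op}(\sigma)$ with domain $\mathcal S(\hbar\mathbb Z^n)$ is $\mathrm{Op}(\sigma^*)$ with domain $\{g\in\ell^2(\hbar\mathbb Z^n):\mathrm{Op}(\sigma^*)g\in\ell^2(\hbar\mathbb Z^n)\}$; and if $\mathrm{Op}(\sigma)$ is a bounded operator on $\ell^2(\hbar\mathbb Z^n)$, then its adjoint is $\mathrm{Op}(\sigma^*)$ on all of $\ell^2(\hbar\mathbb Z^n)$. Moreover $$\sigma^*(k,\theta)\sim\sum_{\alpha}\frac1{\alpha!}\Delta_{\hbar,k}^\alpha D_{\hbar,\theta}^{(\alpha)}\overline{\sigma(k,\theta)},$$ that is, for every $N\in\mathbb N_0$, $$\sigma^*-\sum_{|\alpha|<N}\frac1{\alpha!}\Delta_{\hbar,k}^\alpha D_{\hbar,\theta}^{(\alpha)}\overline{\sigma}\in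 S^{\mu-N(\rho-\delta)}_{\rho,\delta}(\hbar\mathbb Z^n\times\mathbb T^n).$$ -/

import Mathlib

open MeasureTheory
open scoped ComplexConjugate

noncomputable section

namespace HLattice

/-! ### The lattice `ħℤⁿ` and the torus `𝕋ⁿ = ℝⁿ / ℤⁿ`

For `ħ > 0` a point of `ħℤⁿ` is written `k = ħ l` with a unique `l ∈ ℤⁿ`, and a function of
`k ∈ ħℤⁿ` is written as a function of the integer coordinates `l : Fin n → ℤ` of `k`. -/

/-- The point `k = ħ l ∈ ħℤⁿ ⊆ ℝⁿ` with integer coordinates `l`; its norm is the Euclidean one. -/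
def point {n : ℕ} (ħ : ℝ) (l : Fin n → ℤ) : EuclideanSpace ℝ (Fin n) :=
  WithLp.toLp 2 fun j => ħ * (l j : ℝ)

/-- Integer coordinates identify `ℤⁿ` with `ħℤⁿ`. -/
theorem point_injective {n : ℕ} {ħ : ℝ} (h0 : ħ ≠ 0) :
    Function.Injective (point ħ : (Fin n → ℤ) → EuclideanSpace ℝ (Fin n)) := by
  intro l m h
  funext j
  have hj := congrArg (fun x : EuclideanSpace ℝ (Fin n) => x j) h
  simpa [point, h0] using hj

/-- The monomial `UnitAddTorus.mFourier l` is the character `θ ↦ e^{2πi (k · θ) / ħ}` of the point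
`k = ħ l`. -/
theorem mFourier_eq_exp {n : ℕ} {ħ : ℝ} (h0 : ħ ≠ 0) (l : Fin n → ℤ) (x : Fin n → ℝ) :
    UnitAddTorus.mFourier l (fun j => (x j : UnitAddCircle)) =
      Complex.exp (2 * Real.pi * (Complex.I / ħ) * ∑ j, ((point ħ l j * x j : ℝ) : ℂ)) := by
  have hc : (ħ : ℂ) ≠ 0 := by exact_mod_cast h0
  simp only [UnitAddTorus.mFourier, ContinuousMap.coe_mk, fourier_coe_apply, ← Complex.exp_sum,
    point, Finset.mul_sum]
  congr 1
  refine Finset.sum_congr rfl fun j _ => ?_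
  push_cast
  field_simp

/-- Normalised Lebesgue (Haar) measure on `𝕋ⁿ`, of total mass `1`. -/
abbrev torusMeasure (n : ℕ) : Measure (UnitAddTorus (Fin n)) :=
  Measure.pi fun _ => AddCircle.haarAddCircle

/-- `f ∈ C^∞(𝕋ⁿ)`: the `ℤⁿ`-periodic lift of `f` to `ℝⁿ` is smooth. -/
def TorusSmooth {n : ℕ} (f : UnitAddTorus (Fin n) → ℂ) : Prop :=
  ContDiff ℝ ((⊤ : ℕ∞) : WithTop ℕ∞) fun x : Fin n → ℝ => f fun j => (x j : UnitAddCircle)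

theorem TorusSmooth.continuous {n : ℕ} {f : UnitAddTorus (Fin n) → ℂ} (hf : TorusSmooth f) :
    Continuous f := by
  have hq : IsOpenQuotientMap (Pi.map fun (_ : Fin n) (t : ℝ) => (t : UnitAddCircle)) :=
    IsOpenQuotientMap.piMap fun _ => QuotientAddGroup.isOpenQuotientMap_mk
  exact hq.isQuotientMap.continuous_iff.2 (ContDiff.continuous hf)

/-! ### Difference operators and toroidal derivatives -/

/-- `Δ_{ħ,j} g (k) = (g (k + ħ v_j) - g k) / ħ`. -/
def diff {n : ℕ} {E : Type*} [AddCommGroup E] [Module ℝ E] (ħ : ℝ) (j : Fin n)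
    (g : (Fin n → ℤ) → E) : (Fin n → ℤ) → E :=
  fun l => ħ⁻¹ • (g (l + Pi.single j 1) - g l)

/-- `Δ_ħ^α = Δ_{ħ,1}^{α₁} ⋯ Δ_{ħ,n}^{αₙ}`. -/
def mdiff {n : ℕ} {E : Type*} [AddCommGroup E] [Module ℝ E] (ħ : ℝ) (α : Fin n → ℕ)
    (g : (Fin n → ℤ) → E) : (Fin n → ℤ) → E :=
  (List.finRange n).foldr (fun j h => (diff ħ j)^[α j] h) g

/-- `(2πi)⁻¹ ∂f/∂θ_j`. -/
def partialD {n : ℕ} (j : Fin n) (f : UnitAddTorus (Fin n) → ℂ) : UnitAddTorus (Fin n) → ℂ :=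
  fun θ => (2 * Real.pi * Complex.I)⁻¹ *
    deriv (fun t : ℝ => f (θ + Pi.single j (t : UnitAddCircle))) 0

/-- `∏_{m < b} ((2πi)⁻¹ ∂/∂θ_j - m)` applied to `f`. -/
def fallingD {n : ℕ} (j : Fin n) : ℕ → (UnitAddTorus (Fin n) → ℂ) → UnitAddTorus (Fin n) → ℂ
  | 0, f => f
  | b + 1, f => fun θ => partialD j (fallingD j b f) θ - (b : ℂ) * fallingD j b f θ

/-- `D_{ħ,θ}^{(β)} = D_{ħ,θ₁}^{(β₁)} ⋯ D_{ħ,θₙ}^{(βₙ)}`, where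
`D_{ħ,θ_j}^{(b)} = ħ ^ b ∏_{m < b} ((2πi)⁻¹ ∂/∂θ_j - m)`. -/
def mfallingD {n : ℕ} (ħ : ℝ) (β : Fin n → ℕ) (f : UnitAddTorus (Fin n) → ℂ) :
    UnitAddTorus (Fin n) → ℂ :=
  (List.finRange n).foldr (fun j h θ => (ħ : ℂ) ^ β j * fallingD j (β j) h θ) f

/-! ### Symbol classes -/

/-- `σ ∈ S^μ_{ρ,δ}(ħℤⁿ × 𝕋ⁿ)`. -/
structure IsSymbol {n : ℕ} (ħ μ ρ δ : ℝ) (σ : (Fin n → ℤ) → UnitAddTorus (Fin n) → ℂ) :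
    Prop where
  smooth : ∀ k, TorusSmooth (σ k)
  bound : ∀ α β : Fin n → ℕ, ∃ C : ℝ, 0 < C ∧ ∀ k θ,
    ‖mfallingD ħ β (mdiff ħ α σ k) θ‖ ≤
      C * (1 + ‖point ħ k‖) ^ (μ - ρ * ((∑ j, α j : ℕ) : ℝ) + δ * ((∑ j, β j : ℕ) : ℝ))

theorem IsSymbol.continuous {n : ℕ} {ħ μ ρ δ : ℝ}
    {σ : (Fin n → ℤ) → UnitAddTorus (Fin n) → ℂ} (hσ : IsSymbol ħ μ ρ δ σ) (k : Fin n → ℤ) :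
    Continuous (σ k) :=
  (hσ.smooth k).continuous

/-- `σ ∼ ∑_α c_α` in `S^μ_{ρ,δ}`: for every `N` the difference of `σ` and `∑_{|α| < N} c_α`
belongs to `S^{μ - N(ρ - δ)}_{ρ,δ}`. -/
def HasAsymptoticExpansion {n : ℕ} (ħ μ ρ δ : ℝ)
    (σ : (Fin n → ℤ) → UnitAddTorus (Fin n) → ℂ)
    (c : (Fin n → ℕ) → (Fin n → ℤ) → UnitAddTorus (Fin n) → ℂ) : Prop :=
  ∀ N : ℕ, IsSymbol ħ (μ - N * (ρ - δ)) ρ δ fun k θ =>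
    σ k θ - ∑ m ∈ Finset.range N, ∑ α ∈ Finset.piAntidiag Finset.univ m, c α k θ

/-- `(1/α!) Δ_{ħ,k}^α D_{ħ,θ}^{(α)} (conj σ(k,θ))`. -/
def adjointTerm {n : ℕ} (ħ : ℝ) (σ : (Fin n → ℤ) → UnitAddTorus (Fin n) → ℂ) (α : Fin n → ℕ) :
    (Fin n → ℤ) → UnitAddTorus (Fin n) → ℂ :=
  fun k θ => ((∏ j, (α j).factorial : ℕ) : ℂ)⁻¹ *
    mdiff ħ α (fun l => mfallingD ħ α fun φ => conj (σ l φ)) k θ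

/-! ### Fourier transform and quantization on `ℓ²(ħℤⁿ)` -/

/-- The Hilbert space `ℓ²(ħℤⁿ)`. -/
abbrev L2 (n : ℕ) : Type := lp (fun _ : Fin n → ℤ => ℂ) 2

/-- The Fourier transform `f̂(θ) = ∑_k e^{-2πi (k · θ) / ħ} f(k)` of `f ∈ ℓ²(ħℤⁿ)`, the series
being taken in `L²(𝕋ⁿ)`. -/
def fourierL2 {n : ℕ} (f : L2 n) : Lp ℂ 2 (torusMeasure n) :=
  ∑' k : Fin n → ℤ, f k • ContinuousMap.toLp (E := ℂ) 2 (torusMeasure n) ℂ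
    (UnitAddTorus.mFourier (-k))

/-- The series defining `f̂` converges unconditionally in `L²(𝕋ⁿ)`. -/
theorem summable_fourierL2 {n : ℕ} (f : L2 n) :
    Summable fun k : Fin n → ℤ => f k • ContinuousMap.toLp (E := ℂ) 2 (torusMeasure n) ℂ
      (UnitAddTorus.mFourier (-k)) := by
  have ho : Orthonormal ℂ fun k : Fin n → ℤ =>
      ContinuousMap.toLp (E := ℂ) 2 (torusMeasure n) ℂ (UnitAddTorus.mFourier (-k)) :=
    (UnitAddTorus.orthonormal_mFourier (d := Fin n)).comp (fun k => -k) neg_injective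
  simpa [LinearIsometry.toSpanSingleton] using ho.orthogonalFamily.summable_of_lp f

theorem fourierL2_add {n : ℕ} (f g : L2 n) : fourierL2 (f + g) = fourierL2 f + fourierL2 g := by
  simp only [fourierL2]
  rw [← (summable_fourierL2 f).tsum_add (summable_fourierL2 g)]
  exact tsum_congr fun k => by simp [add_smul]

theorem fourierL2_smul {n : ℕ} (c : ℂ) (f : L2 n) : fourierL2 (c • f) = c • fourierL2 f := by
  simp only [fourierL2]
  rw [← (summable_fourierL2 f).tsum_const_smul c]
  exact tsum_congr fun k => by simp [mul_smul]

/-- `Op_ħ(σ) f (k) = ∫_{𝕋ⁿ} e^{2πi (k · θ) / ħ} σ(k,θ) f̂(θ) dθ` for `f ∈ ℓ²(ħℤⁿ)`. -/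
def opFun {n : ℕ} (σ : (Fin n → ℤ) → UnitAddTorus (Fin n) → ℂ) (f : L2 n) (k : Fin n → ℤ) : ℂ :=
  ∫ θ, UnitAddTorus.mFourier k θ * σ k θ * fourierL2 f θ ∂(torusMeasure n)

theorem integrable_opFun {n : ℕ} {σ : (Fin n → ℤ) → UnitAddTorus (Fin n) → ℂ}
    (hσ : ∀ k, Continuous (σ k)) (f : L2 n) (k : Fin n → ℤ) :
    Integrable (fun θ => UnitAddTorus.mFourier k θ * σ k θ * fourierL2 f θ) (torusMeasure n) := by
  have hc : Continuous fun θ => UnitAddTorus.mFourier k θ * σ k θ :=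
    (UnitAddTorus.mFourier k).continuous.mul (hσ k)
  obtain ⟨C, hC⟩ := isCompact_univ.exists_bound_of_continuousOn hc.continuousOn
  exact ((Lp.memLp (fourierL2 f)).integrable (by norm_num)).bdd_mul hc.aestronglyMeasurable
    (Filter.Eventually.of_forall fun θ => hC θ (Set.mem_univ θ))

theorem opFun_add {n : ℕ} {σ : (Fin n → ℤ) → UnitAddTorus (Fin n) → ℂ}
    (hσ : ∀ k, Continuous (σ k)) (f g : L2 n) : opFun σ (f + g) = opFun σ f + opFun σ g := by
  funext k
  simp only [opFun, Pi.add_apply, fourierL2_add]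
  rw [← integral_add (integrable_opFun hσ f k) (integrable_opFun hσ g k)]
  refine integral_congr_ae ?_
  filter_upwards [Lp.coeFn_add (fourierL2 f) (fourierL2 g)] with θ hθ
  rw [hθ, Pi.add_apply, mul_add]

theorem opFun_smul {n : ℕ} (σ : (Fin n → ℤ) → UnitAddTorus (Fin n) → ℂ) (c : ℂ) (f : L2 n) :
    opFun σ (c • f) = c • opFun σ f := by
  funext k
  simp only [opFun, Pi.smul_apply, fourierL2_smul]
  rw [← integral_smul]
  refine integral_congr_ae ?_
  filter_upwards [Lp.coeFn_smul c (fourierL2 f)] with θ hθ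
  rw [hθ, Pi.smul_apply, smul_eq_mul, smul_eq_mul]
  ring

/-- `Op_ħ(σ)` as an operator in `ℓ²(ħℤⁿ)` with its maximal domain
`{f ∈ ℓ² : Op_ħ(σ) f ∈ ℓ²}`. -/
def opMax {n : ℕ} (σ : (Fin n → ℤ) → UnitAddTorus (Fin n) → ℂ) (hσ : ∀ k, Continuous (σ k)) :
    L2 n →ₗ.[ℂ] L2 n where
  domain :=
    { carrier := {f | Memℓp (opFun σ f) 2}
      add_mem' := fun {f g} hf hg => by
        simp only [Set.mem_ofPred_eq] at hf hg ⊢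
        rw [opFun_add hσ]
        exact hf.add hg
      zero_mem' := by
        have h := opFun_smul σ 0 (0 : L2 n)
        simp only [zero_smul] at h
        simp only [Set.mem_ofPred_eq, h]
        exact zero_memℓp
      smul_mem' := fun c f hf => by
        simp only [Set.mem_ofPred_eq] at hf ⊢
        rw [opFun_smul]
        exact hf.const_smul c }
  toFun :=
    { toFun := fun f => ⟨opFun σ f, f.2⟩
      map_add' := fun f g => Subtype.ext (opFun_add hσ f g)
      map_smul' := fun c f => Subtype.ext (opFun_smul σ c f) }

/-- The Schwartz space `𝒮(ħℤⁿ)`, as a subspace of `ℓ²(ħℤⁿ)`. -/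
def schwartz (n : ℕ) (ħ : ℝ) : Submodule ℂ (L2 n) where
  carrier := {f | ∀ N : ℕ, ∃ C : ℝ, ∀ k, ‖f k‖ ≤ C * (1 + ‖point ħ k‖) ^ (-(N : ℝ))}
  add_mem' := fun {f g} hf hg N => by
    obtain ⟨C, hC⟩ := hf N
    obtain ⟨D, hD⟩ := hg N
    refine ⟨C + D, fun k => ?_⟩
    rw [add_mul]
    exact (norm_add_le _ _).trans (add_le_add (hC k) (hD k))
  zero_mem' := fun N => ⟨0, fun k => by simp⟩
  smul_mem' := fun c f hf N => by
    obtain ⟨C, hC⟩ := hf N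
    refine ⟨‖c‖ * C, fun k => ?_⟩
    rw [mul_assoc]
    exact (norm_smul c (f k)).le.trans (mul_le_mul_of_nonneg_left (hC k) (norm_nonneg c))

/-- `Op_ħ(σ)` as an operator in `ℓ²(ħℤⁿ)` with domain `𝒮(ħℤⁿ)` (more precisely, those
`f ∈ 𝒮(ħℤⁿ)` for which `Op_ħ(σ) f ∈ ℓ²`). -/
def opSchwartz {n : ℕ} (ħ : ℝ) (σ : (Fin n → ℤ) → UnitAddTorus (Fin n) → ℂ)
    (hσ : ∀ k, Continuous (σ k)) : L2 n →ₗ.[ℂ] L2 n :=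
  (opMax σ hσ).domRestrict (schwartz n ħ)

end HLattice

end

open MeasureTheory
open scoped ComplexConjugate

noncomputable section

namespace HLattice

/-! ### The weight `1 + |k|` -/

/-! Expanding `f̂` in characters shows that Op(σ) is an infinite matrix, with entry `coef (σ k) (j -
k)` in row k and column j. Its conjugate transpose has the same shape: it is the matrix of the
symbol whose Fourier coefficients are c(k + m, m), where c(k, m) = conj of `coef (σ k) (-m)` are the
coefficients of conj σ. This is `adjointSymbol`, and the theorem reduces to estimates on c(k + m,
m).

The discrete Taylor formula in k with increment m expands c(k + m, m). The coefficient (1/α!) ħ^|α|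
∏ m_j (m_j - 1) ⋯ (m_j - α_j + 1) of Δ^α c(k, m) is exactly the Fourier multiplier of D^(α)/α!, so
the Taylor polynomials are the partial sums of the asymptotic series. What remains is the remainder
(`norm_sub_taylor_le`, `SymSeq.taylorRem`). Each difference gains ρ powers of 1 + |k|; each power of
decay in m is bought with a polynomial multiplier and costs δ powers; moving the base point from k
to k + y costs powers of 1 + |m|, by Peetre's inequality. Since δ < ρ, a high Taylor order with
matched decay exponent (`exists_order_taylorRem`) makes the remainder smaller than any prescribed
negative powers of both weights. A remainder of lower order differs from such a one by finitely many
Taylor terms, all of admissible order.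

On Schwartz f the matrix entries times f are absolutely summable because δ < 1, so Fubini makes the
two operators formal adjoints. Conversely, testing the Hilbert space adjoint on basis vectors reads
off its coordinates, which are those of Op of the adjoint symbol; this identifies the domain, and
also settles the bounded case. -/

/-- The weight `1 + |k|` at the point `k` of `ħℤⁿ`. -/
def wt {n : ℕ} (ħ : ℝ) (k : Fin n → ℤ) : ℝ := 1 + ‖point ħ k‖

section Weight

variable {n : ℕ} {ħ : ℝ}

theorem point_add (k m : Fin n → ℤ) : point ħ (k + m) = point ħ k + point ħ m := by
  ext j
  simp [point, mul_add]

theorem point_neg (m : Fin n → ℤ) : point ħ (-m) = -point ħ m := by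
  ext j
  simp [point]

theorem one_le_wt (k : Fin n → ℤ) : 1 ≤ wt ħ k := by
  simp [wt]

theorem wt_pos (k : Fin n → ℤ) : 0 < wt ħ k := zero_lt_one.trans_le (one_le_wt k)

theorem wt_neg (k : Fin n → ℤ) : wt ħ (-k) = wt ħ k := by
  simp [wt, point_neg]

theorem wt_rpow_pos (k : Fin n → ℤ) (s : ℝ) : 0 < wt ħ k ^ s := Real.rpow_pos_of_pos (wt_pos k) s

theorem wt_rpow_mono (k : Fin n → ℤ) {s t : ℝ} (h : s ≤ t) : wt ħ k ^ s ≤ wt ħ k ^ t :=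
  Real.rpow_le_rpow_of_exponent_le (one_le_wt k) h

theorem wt_add_le (k m : Fin n → ℤ) : wt ħ (k + m) ≤ wt ħ k * wt ħ m := by
  simp only [wt, point_add]
  nlinarith [norm_add_le (point ħ k) (point ħ m), norm_nonneg (point ħ k),
    norm_nonneg (point ħ m), mul_nonneg (norm_nonneg (point ħ k)) (norm_nonneg (point ħ m))]

/-- Peetre's inequality. -/
theorem wt_add_rpow_le (k m : Fin n → ℤ) (s : ℝ) :
    wt ħ (k + m) ^ s ≤ wt ħ k ^ s * wt ħ m ^ |s| := by
  rcases le_or_gt 0 s with hs | hs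
  · rw [abs_of_nonneg hs, ← Real.mul_rpow (wt_pos k).le (wt_pos m).le]
    exact Real.rpow_le_rpow (wt_pos _).le (wt_add_le k m) hs
  · have h : wt ħ k ≤ wt ħ (k + m) * wt ħ m := by
      simpa [wt_neg] using wt_add_le (ħ := ħ) (k + m) (-m)
    have h2 := Real.rpow_le_rpow_of_nonpos (wt_pos k) h hs.le
    rw [Real.mul_rpow (wt_pos _).le (wt_pos _).le] at h2
    rw [abs_of_neg hs]
    calc wt ħ (k + m) ^ s = wt ħ (k + m) ^ s * wt ħ m ^ s * wt ħ m ^ (-s) := by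
          rw [mul_assoc, ← Real.rpow_add (wt_pos m)]; simp
      _ ≤ _ := mul_le_mul_of_nonneg_right h2 (wt_rpow_pos m _).le

theorem abs_mul_coord_le (m : Fin n → ℤ) (j : Fin n) : |ħ * (m j : ℝ)| ≤ ‖point ħ m‖ := by
  simpa [point] using PiLp.norm_apply_le (point ħ m) j

theorem norm_coord_le (h0 : 0 < ħ) (m : Fin n → ℤ) (j : Fin n) :
    ‖(m j : ℂ)‖ ≤ ħ⁻¹ * wt ħ m := by
  have h := abs_mul_coord_le (ħ := ħ) m j
  rw [abs_mul, abs_of_pos h0] at h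
  rw [Complex.norm_intCast, inv_mul_eq_div, le_div_iff₀ h0, wt]
  linarith

/-- The `ℓ¹` length of an integer vector. -/
def size (m : Fin n → ℤ) : ℕ := ∑ j, (m j).natAbs

theorem wt_le_size (h0 : 0 < ħ) (m : Fin n → ℤ) : wt ħ m ≤ 1 + ħ * size m := by
  have h : ‖point ħ m‖ ≤ ∑ j, |ħ * (m j : ℝ)| := by
    rw [EuclideanSpace.norm_eq, Real.sqrt_le_left (Finset.sum_nonneg fun _ _ => abs_nonneg _)]
    simpa [point] using Finset.sum_sq_le_sq_sum_of_nonneg (s := Finset.univ)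
      (f := fun j => |ħ * (m j : ℝ)|) fun _ _ => abs_nonneg _
  have h2 : ∑ j, |ħ * (m j : ℝ)| = ħ * size m := by
    simp [size, Finset.mul_sum, abs_mul, abs_of_pos h0]
  rw [wt]
  linarith

theorem mul_size_le (h0 : 0 < ħ) (m : Fin n → ℤ) : ħ * size m ≤ n * wt ħ m := by
  calc ħ * size m = ∑ j, |ħ * (m j : ℝ)| := by
        simp [size, Finset.mul_sum, abs_mul, abs_of_pos h0]
    _ ≤ ∑ _j : Fin n, wt ħ m := Finset.sum_le_sum fun j _ =>
        (abs_mul_coord_le m j).trans (by simp [wt])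
    _ = n * wt ħ m := by simp

/-- The Taylor remainder samples points of an ℓ¹ ball, while the symbol weight is Euclidean; the
dimensional factor pays for the change of norm. -/
theorem wt_le_of_size_le (h0 : 0 < ħ) {y m : Fin n → ℤ} (h : size y ≤ size m) :
    wt ħ y ≤ (1 + n) * wt ħ m := by
  have h1 := wt_le_size h0 y
  have h2 := mul_size_le h0 m
  have h3 : ħ * size y ≤ ħ * size m := by gcongr
  have h4 := one_le_wt (ħ := ħ) m
  linarith

theorem mul_norm_le_wt (h0 : 0 < ħ) (m : Fin n → ℤ) :
    ħ * ‖(fun j => (m j : ℝ) : Fin n → ℝ)‖ ≤ wt ħ m := by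
  rw [mul_comm, ← le_div_iff₀ h0, pi_norm_le_iff_of_nonneg (div_nonneg (wt_pos m).le h0.le)]
  intro j
  simpa [inv_mul_eq_div] using norm_coord_le h0 m j

theorem summable_wt (h0 : 0 < ħ) :
    Summable fun m : Fin n → ℤ => wt ħ m ^ (-((n + 1 : ℕ) : ℝ)) := by
  classical
  let L := Submodule.span ℤ (Set.range (Pi.basisFun ℝ (Fin n)))
  have hr : Module.finrank ℤ L < n + 1 := by
    have := ZLattice.rank ℝ L
    simp only [Module.finrank_fintype_fun_eq_card, Fintype.card_fin] at this
    omega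
  have hs := ZLattice.summable_norm_pow_inv L (n + 1) hr
  let e : (Fin n → ℤ) → L := fun m => ⟨fun j => (m j : ℝ), by
    have : (fun j => (m j : ℝ)) = ∑ j, m j • Pi.basisFun ℝ (Fin n) j := by
      ext i
      simp [Finset.sum_apply, Pi.single_apply]
    rw [this]
    exact Submodule.sum_mem _ fun j _ =>
      Submodule.smul_mem _ _ (Submodule.subset_span ⟨j, rfl⟩)⟩
  have he : Function.Injective e := by
    intro a b hab
    funext j
    have : (a j : ℝ) = b j := congrFun (congrArg Subtype.val hab) j
    exact_mod_cast this
  have h1 := (hs.comp_injective he).mul_left ((ħ⁻¹) ^ (n + 1))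
  refine h1.of_norm_bounded_eventually ?_
  -- The comparison with ‖m‖⁻¹ fails only at m = 0, where Lean's inverse of zero is zero.
  filter_upwards [(Set.finite_singleton (0 : Fin n → ℤ)).compl_mem_cofinite] with m hm
  have hpos : 0 < ‖(fun j => (m j : ℝ) : Fin n → ℝ)‖ := by
    rw [norm_pos_iff]
    intro h
    apply hm
    ext j
    have := congrFun h j
    simpa using this
  rw [Real.norm_of_nonneg (wt_rpow_pos _ _).le, Real.rpow_neg (wt_pos m).le, Real.rpow_natCast,
    ← inv_pow]
  change _ ≤ _ * ‖(fun j => (m j : ℝ) : Fin n → ℝ)‖⁻¹ ^ (n + 1)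
  rw [← mul_pow, ← mul_inv]
  exact pow_le_pow_left₀ (inv_nonneg.2 (wt_pos m).le)
    (inv_anti₀ (mul_pos h0 hpos) (mul_norm_le_wt h0 m)) _

end Weight

/-! ### Rapidly decreasing sequences and their Fourier series -/

/-- `c` decays faster than every power of the weight. -/
def Rapid {n : ℕ} (ħ : ℝ) (c : (Fin n → ℤ) → ℂ) : Prop :=
  ∀ N : ℕ, ∃ C : ℝ, ∀ m, ‖c m‖ ≤ C * wt ħ m ^ (-(N : ℝ))

/-- Polynomial functions of degree at most `d` on `ℤⁿ`. -/
inductive IsPoly {n : ℕ} : ℕ → ((Fin n → ℤ) → ℂ) → Prop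
  | const (d : ℕ) (a : ℂ) : IsPoly d fun _ => a
  | coord {d : ℕ} {p : (Fin n → ℤ) → ℂ} (j : Fin n) (h : IsPoly d p) :
      IsPoly (d + 1) fun m => (m j : ℂ) * p m
  | add {d : ℕ} {p q : (Fin n → ℤ) → ℂ} (hp : IsPoly d p) (hq : IsPoly d q) :
      IsPoly d fun m => p m + q m

namespace IsPoly

variable {n : ℕ} {d e : ℕ} {p q : (Fin n → ℤ) → ℂ}

theorem mono (hp : IsPoly d p) (h : d ≤ e) : IsPoly e p := by
  induction hp generalizing e with
  | const d a => exact const e a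
  | @coord d p j _ ih =>
    obtain ⟨e, rfl⟩ : ∃ e', e = e' + 1 := ⟨e - 1, by omega⟩
    exact coord j (ih (by omega))
  | add _ _ ih1 ih2 => exact add (ih1 h) (ih2 h)

theorem const_mul (a : ℂ) (hp : IsPoly d p) : IsPoly d fun m => a * p m := by
  induction hp with
  | const d b => exact const d (a * b)
  | coord j _ ih => simpa only [mul_left_comm] using coord j ih
  | add _ _ ih1 ih2 => simpa only [mul_add] using add ih1 ih2

theorem mul (hp : IsPoly d p) (hq : IsPoly e q) : IsPoly (d + e) fun m => p m * q m := by
  induction hp with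
  | const d a => exact (hq.const_mul a).mono (by omega)
  | @coord d p j _ ih =>
    have h := coord j ih
    rw [show d + e + 1 = d + 1 + e by omega] at h
    simpa only [mul_assoc] using h
  | add _ _ ih1 ih2 => simpa only [add_mul] using add ih1 ih2

theorem prod {ι : Type*} (s : Finset ι) {d : ι → ℕ} {p : ι → (Fin n → ℤ) → ℂ}
    (h : ∀ i ∈ s, IsPoly (d i) (p i)) : IsPoly (∑ i ∈ s, d i) fun m => ∏ i ∈ s, p i m := by
  classical
  induction s using Finset.induction_on with
  | empty => simpa using const 0 1
  | insert a s ha ih =>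
    simp only [Finset.sum_insert ha, Finset.prod_insert ha]
    exact (h a (Finset.mem_insert_self a s)).mul
      (ih fun i hi => h i (Finset.mem_insert_of_mem hi))

theorem sum {ι : Type*} (s : Finset ι) {p : ι → (Fin n → ℤ) → ℂ}
    (h : ∀ i ∈ s, IsPoly d (p i)) : IsPoly d fun m => ∑ i ∈ s, p i m := by
  classical
  induction s using Finset.induction_on with
  | empty => simpa using const d 0
  | insert a s ha ih =>
    simp only [Finset.sum_insert ha]
    exact (h a (Finset.mem_insert_self a s)).add
      (ih fun i hi => h i (Finset.mem_insert_of_mem hi))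

theorem pow (hp : IsPoly d p) (N : ℕ) : IsPoly (N * d) fun m => p m ^ N := by
  simpa using prod (Finset.range N) fun _ _ => hp

theorem coordinate (j : Fin n) : IsPoly 1 fun m => (m j : ℂ) := by
  simpa using coord j (const 0 1)

/-- Conjugating a Fourier series sends the coefficient at m to the conjugate of the one at -m, so
multipliers change by p ↦ conj p(-·). -/
theorem conj_neg (hp : IsPoly d p) : IsPoly d fun m => conj (p (-m)) := by
  induction hp with
  | const d a => exact const d (conj a)
  | coord j _ ih => simpa using (coord j ih).const_mul (-1)
  | add _ _ ih1 ih2 => simpa using add ih1 ih2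

theorem exists_bound {ħ : ℝ} (h0 : 0 < ħ) (hp : IsPoly d p) :
    ∃ C : ℝ, 0 ≤ C ∧ ∀ m, ‖p m‖ ≤ C * wt ħ m ^ (d : ℝ) := by
  induction hp with
  | const d a =>
    refine ⟨‖a‖, norm_nonneg a, fun m => le_mul_of_one_le_right (norm_nonneg a) ?_⟩
    exact Real.one_le_rpow (one_le_wt m) (Nat.cast_nonneg d)
  | @coord d p j _ ih =>
    obtain ⟨C, hC, h⟩ := ih
    refine ⟨ħ⁻¹ * C, mul_nonneg (inv_nonneg.2 h0.le) hC, fun m => ?_⟩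
    rw [norm_mul, Nat.cast_add, Nat.cast_one, Real.rpow_add (wt_pos m), Real.rpow_one]
    calc ‖(m j : ℂ)‖ * ‖p m‖ ≤ (ħ⁻¹ * wt ħ m) * (C * wt ħ m ^ (d : ℝ)) :=
          mul_le_mul (norm_coord_le h0 m j) (h m) (norm_nonneg _)
            (mul_nonneg (inv_nonneg.2 h0.le) (wt_pos m).le)
      _ = _ := by ring
  | add _ _ ih1 ih2 =>
    obtain ⟨C, hC, h1⟩ := ih1
    obtain ⟨D, hD, h2⟩ := ih2
    refine ⟨C + D, add_nonneg hC hD, fun m => ?_⟩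
    rw [add_mul]
    exact (norm_add_le _ _).trans (add_le_add (h1 m) (h2 m))

end IsPoly

/-- A polynomial of degree `2 N` that dominates `(1 + |m|) ^ (2 N)`. -/
theorem exists_isPoly_wt_le {n : ℕ} (ħ : ℝ) (N : ℕ) :
    ∃ p : (Fin n → ℤ) → ℂ, IsPoly (2 * N) p ∧ ∀ m, wt ħ m ^ ((2 * N : ℕ) : ℝ) ≤ ‖p m‖ := by
  -- The inequality (1 + x)² ≤ 2(1 + x²), raised to the power N, with x² = |ħm|² polynomial in m.
  refine ⟨fun m => (2 * (1 + ∑ j, (ħ ^ 2 : ℂ) * ((m j : ℂ) * (m j : ℂ)))) ^ N, ?_, fun m => ?_⟩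
  · have h : IsPoly 2 fun m : Fin n → ℤ =>
        2 * (1 + ∑ j, (ħ ^ 2 : ℂ) * ((m j : ℂ) * (m j : ℂ))) :=
      ((IsPoly.const 2 1).add (IsPoly.sum _ fun j _ =>
        ((IsPoly.coordinate j).mul (IsPoly.coordinate j)).const_mul _)).const_mul 2
    simpa [mul_comm] using h.pow N
  · have h1 : (2 * (1 + ∑ j, (ħ ^ 2 : ℂ) * ((m j : ℂ) * (m j : ℂ))) : ℂ) =
        ((2 * (1 + ‖point ħ m‖ ^ 2) : ℝ) : ℂ) := by
      rw [EuclideanSpace.real_norm_sq_eq]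
      push_cast [point]
      congr 2
      exact Finset.sum_congr rfl fun j _ => by ring
    change _ ≤ ‖(2 * (1 + ∑ j, (ħ ^ 2 : ℂ) * ((m j : ℂ) * (m j : ℂ)))) ^ N‖
    rw [Real.rpow_natCast, pow_mul, h1, norm_pow, Complex.norm_real]
    refine pow_le_pow_left₀ (sq_nonneg _) ?_ N
    rw [Real.norm_of_nonneg (by positivity), wt]
    nlinarith [sq_nonneg (1 - ‖point ħ m‖)]

namespace Rapid

variable {n : ℕ} {ħ : ℝ} {c c' : (Fin n → ℤ) → ℂ}

theorem zero : Rapid ħ (0 : (Fin n → ℤ) → ℂ) := fun _ => ⟨0, fun m => by simp⟩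

theorem add (h : Rapid ħ c) (h' : Rapid ħ c') : Rapid ħ fun m => c m + c' m := fun N => by
  obtain ⟨C, hC⟩ := h N
  obtain ⟨D, hD⟩ := h' N
  refine ⟨C + D, fun m => ?_⟩
  rw [add_mul]
  exact (norm_add_le _ _).trans (add_le_add (hC m) (hD m))

theorem const_mul (a : ℂ) (h : Rapid ħ c) : Rapid ħ fun m => a * c m := fun N => by
  obtain ⟨C, hC⟩ := h N
  refine ⟨‖a‖ * C, fun m => ?_⟩
  rw [norm_mul, mul_assoc]
  exact mul_le_mul_of_nonneg_left (hC m) (norm_nonneg a)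

theorem sub (h : Rapid ħ c) (h' : Rapid ħ c') : Rapid ħ fun m => c m - c' m := by
  simpa [sub_eq_add_neg] using h.add (h'.const_mul (-1))

theorem sum {ι : Type*} (s : Finset ι) {f : ι → (Fin n → ℤ) → ℂ} (h : ∀ i ∈ s, Rapid ħ (f i)) :
    Rapid ħ fun m => ∑ i ∈ s, f i m := by
  classical
  induction s using Finset.induction_on with
  | empty => simpa using! zero
  | insert a s ha ih =>
    simp only [Finset.sum_insert ha]
    exact (h a (Finset.mem_insert_self a s)).add
      (ih fun i hi => h i (Finset.mem_insert_of_mem hi))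

theorem of_le_of_le {d : ℕ} {A : ℝ} (hA : 0 ≤ A) (h : Rapid ħ c)
    (hc : ∀ m, ‖c' m‖ ≤ A * wt ħ m ^ (d : ℝ) * ‖c m‖) : Rapid ħ c' := fun N => by
  obtain ⟨C, hC⟩ := h (N + d)
  refine ⟨A * C, fun m => (hc m).trans ?_⟩
  calc A * wt ħ m ^ (d : ℝ) * ‖c m‖
      ≤ A * wt ħ m ^ (d : ℝ) * (C * wt ħ m ^ (-((N + d : ℕ) : ℝ))) :=
        mul_le_mul_of_nonneg_left (hC m) (mul_nonneg hA (wt_rpow_pos m _).le)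
    _ = A * C * (wt ħ m ^ (d : ℝ) * wt ħ m ^ (-((N + d : ℕ) : ℝ))) := by ring
    _ = _ := by
        rw [← Real.rpow_add (wt_pos m)]
        congr 2
        push_cast
        ring

theorem poly_mul (h0 : 0 < ħ) {d : ℕ} {p : (Fin n → ℤ) → ℂ} (hp : IsPoly d p) (h : Rapid ħ c) :
    Rapid ħ fun m => p m * c m := by
  obtain ⟨A, hA, hb⟩ := hp.exists_bound h0
  refine h.of_le_of_le (d := d) hA fun m => ?_
  rw [norm_mul]
  exact mul_le_mul_of_nonneg_right (hb m) (norm_nonneg _)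

theorem conj_neg (h : Rapid ħ c) : Rapid ħ fun m => conj (c (-m)) := fun N => by
  obtain ⟨C, hC⟩ := h N
  exact ⟨C, fun m => by simpa [wt_neg] using hC (-m)⟩

theorem summable_norm (h0 : 0 < ħ) (h : Rapid ħ c) : Summable fun m => ‖c m‖ := by
  obtain ⟨C, hC⟩ := h (n + 1)
  exact Summable.of_nonneg_of_le (fun _ => norm_nonneg _) hC ((summable_wt h0).mul_left C)

end Rapid

/-- The Fourier series with coefficients `c`. -/
def synth {n : ℕ} (c : (Fin n → ℤ) → ℂ) (θ : UnitAddTorus (Fin n)) : ℂ :=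
  ∑' m, c m * UnitAddTorus.mFourier m θ

section Synth

variable {n : ℕ} {ħ : ℝ} {c c' : (Fin n → ℤ) → ℂ}

theorem norm_mFourier_apply (m : Fin n → ℤ) (θ : UnitAddTorus (Fin n)) :
    ‖UnitAddTorus.mFourier m θ‖ = 1 := by
  simp only [UnitAddTorus.mFourier, ContinuousMap.coe_mk, fourier_apply, norm_prod,
    Circle.norm_coe, Finset.prod_const_one]

theorem summable_synth (h : Summable fun m => ‖c m‖) (θ : UnitAddTorus (Fin n)) :
    Summable fun m => c m * UnitAddTorus.mFourier m θ :=
  Summable.of_norm (by simpa [norm_mFourier_apply] using h)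

theorem synth_zero : synth (fun _ => 0 : (Fin n → ℤ) → ℂ) = 0 := by
  funext θ
  simp [synth]

theorem synth_add (h0 : 0 < ħ) (h : Rapid ħ c) (h' : Rapid ħ c') (θ : UnitAddTorus (Fin n)) :
    synth (fun m => c m + c' m) θ = synth c θ + synth c' θ := by
  simp only [synth, add_mul]
  exact (summable_synth (h.summable_norm h0) θ).tsum_add (summable_synth (h'.summable_norm h0) θ)

theorem synth_const_mul (a : ℂ) (θ : UnitAddTorus (Fin n)) :
    synth (fun m => a * c m) θ = a * synth c θ := by
  simp only [synth, mul_assoc, tsum_mul_left]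

theorem synth_sub (h0 : 0 < ħ) (h : Rapid ħ c) (h' : Rapid ħ c') (θ : UnitAddTorus (Fin n)) :
    synth (fun m => c m - c' m) θ = synth c θ - synth c' θ := by
  have := synth_add h0 h (h'.const_mul (-1)) θ
  rw [synth_const_mul] at this
  simpa [sub_eq_add_neg] using this

theorem synth_sum (h0 : 0 < ħ) {ι : Type*} (s : Finset ι) {f : ι → (Fin n → ℤ) → ℂ}
    (h : ∀ i ∈ s, Rapid ħ (f i)) (θ : UnitAddTorus (Fin n)) :
    synth (fun m => ∑ i ∈ s, f i m) θ = ∑ i ∈ s, synth (f i) θ := by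
  simp only [synth, Finset.sum_mul]
  exact Summable.tsum_finsetSum fun i hi => summable_synth ((h i hi).summable_norm h0) θ

theorem synth_conj_neg (θ : UnitAddTorus (Fin n)) :
    synth (fun m => conj (c (-m))) θ = conj (synth c θ) := by
  rw [synth, synth, Complex.conj_tsum, ← (Equiv.neg (Fin n → ℤ)).tsum_eq]
  simp [UnitAddTorus.mFourier_neg]

/-- The linear form `x ↦ ∑ m_j x_j`. -/
def pairing (m : Fin n → ℤ) : (Fin n → ℝ) →L[ℝ] ℝ :=
  ∑ j, (m j : ℝ) • ContinuousLinearMap.proj j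

theorem norm_pairing_le (h0 : 0 < ħ) (m : Fin n → ℤ) : ‖pairing m‖ ≤ n * ħ⁻¹ * wt ħ m := by
  refine (norm_sum_le _ _).trans ?_
  have : ∀ j ∈ (Finset.univ : Finset (Fin n)),
      ‖(m j : ℝ) • (ContinuousLinearMap.proj j : (Fin n → ℝ) →L[ℝ] ℝ)‖ ≤ ħ⁻¹ * wt ħ m := by
    intro j _
    rw [norm_smul]
    have h1 : ‖(m j : ℝ)‖ ≤ ħ⁻¹ * wt ħ m := by simpa using norm_coord_le h0 m j
    have h2 : ‖(ContinuousLinearMap.proj j : (Fin n → ℝ) →L[ℝ] ℝ)‖ ≤ 1 :=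
      ContinuousLinearMap.opNorm_le_bound _ zero_le_one fun x => by
        simpa using norm_le_pi_norm x j
    exact (mul_le_mul h1 h2 (norm_nonneg _) ((norm_nonneg _).trans h1)).trans (by simp)
  refine (Finset.sum_le_sum this).trans ?_
  simp [mul_assoc]

theorem mFourier_coe (m : Fin n → ℤ) (x : Fin n → ℝ) :
    UnitAddTorus.mFourier m (fun j => (x j : UnitAddCircle)) =
      Complex.exp (2 * Real.pi * Complex.I * (pairing m x : ℝ)) := by
  simp only [UnitAddTorus.mFourier, ContinuousMap.coe_mk, fourier_coe_apply, ← Complex.exp_sum,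
    pairing]
  congr 1
  simp only [sum_apply, Complex.ofReal_sum, Finset.mul_sum]
  refine Finset.sum_congr rfl fun j _ => ?_
  simp
  ring

theorem contDiff_exp_real (a : ℂ) {N : WithTop ℕ∞} :
    ContDiff ℝ N fun t : ℝ => Complex.exp (a * t) :=
  (contDiff_const.mul Complex.ofRealCLM.contDiff).cexp

theorem iteratedDeriv_exp_real (a : ℂ) (k : ℕ) :
    iteratedDeriv k (fun t : ℝ => Complex.exp (a * t)) =
      fun t : ℝ => a ^ k * Complex.exp (a * t) := by
  induction k with
  | zero => simp
  | succ k ih =>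
    rw [iteratedDeriv_succ, ih]
    funext t
    have h : HasDerivAt (fun t : ℝ => a * (t : ℂ)) a t := by
      simpa using (Complex.ofRealCLM.hasDerivAt (x := t)).const_mul a
    rw [(h.cexp.const_mul (a ^ k)).deriv]
    ring

/-- Termwise differentiation: the k-th derivative of a character is of size at most a constant times
a k-th power of the weight, which rapid decay absorbs. -/
theorem torusSmooth_synth (h0 : 0 < ħ) (h : Rapid ħ c) : TorusSmooth (synth c) := by
  have hterm : ∀ (m : Fin n → ℤ) (x : Fin n → ℝ),
      c m * UnitAddTorus.mFourier m (fun j => (x j : UnitAddCircle)) =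
        c m • ((fun t : ℝ => Complex.exp (2 * Real.pi * Complex.I * t)) ∘ pairing m) x := by
    intro m x
    simp [mFourier_coe]
  have hg : ContDiff ℝ ((⊤ : ℕ∞) : WithTop ℕ∞)
      fun t : ℝ => Complex.exp (2 * Real.pi * Complex.I * t) := contDiff_exp_real _
  simp only [TorusSmooth, synth, hterm]
  refine contDiff_tsum
    (v := fun k m => ‖c m‖ * ((2 * Real.pi) ^ k * (n * ħ⁻¹ * wt ħ m) ^ k))
    (fun m => (hg.comp (pairing m).contDiff).const_smul (c m)) ?_ ?_
  · intro k _
    have hr : Rapid ħ fun m => (((2 * Real.pi) ^ k * (n * ħ⁻¹ * wt ħ m) ^ k : ℝ) : ℂ) * c m := by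
      refine h.of_le_of_le (d := k) (A := (2 * Real.pi) ^ k * (n * ħ⁻¹) ^ k) (by positivity)
        fun m => ?_
      have := wt_pos (ħ := ħ) m
      rw [norm_mul, Complex.norm_real, Real.norm_of_nonneg (by positivity), Real.rpow_natCast,
        mul_pow _ (wt ħ m)]
      exact le_of_eq (by ring)
    refine (hr.summable_norm h0).congr fun m => ?_
    have := wt_pos (ħ := ħ) m
    rw [norm_mul, Complex.norm_real, Real.norm_of_nonneg (by positivity), mul_comm]
  · intro k m x hk
    have hk' : (k : WithTop ℕ∞) ≤ ((⊤ : ℕ∞) : WithTop ℕ∞) := by exact_mod_cast hk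
    rw [show (fun x => c m • ((fun t : ℝ => Complex.exp (2 * Real.pi * Complex.I * t)) ∘
        pairing m) x) = c m • ((fun t : ℝ => Complex.exp (2 * Real.pi * Complex.I * t)) ∘
        pairing m) from rfl, iteratedFDeriv_const_smul_apply ((hg.comp (pairing m).contDiff).of_le hk').contDiffAt,
      norm_smul, ContinuousLinearMap.iteratedFDeriv_comp_right _ hg _ hk']
    refine mul_le_mul_of_nonneg_left ?_ (norm_nonneg _)
    refine (ContinuousMultilinearMap.norm_compContinuousLinearMap_le _ _).trans ?_
    rw [norm_iteratedFDeriv_eq_norm_iteratedDeriv, iteratedDeriv_exp_real, Finset.prod_const,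
      Finset.card_univ, Fintype.card_fin]
    refine mul_le_mul ?_ (pow_le_pow_left₀ (norm_nonneg _) (norm_pairing_le h0 m) k)
      (by positivity) (by positivity)
    rw [norm_mul, norm_pow, show 2 * (Real.pi : ℂ) * Complex.I * (pairing m x : ℝ) =
      ((2 * Real.pi * pairing m x : ℝ) : ℂ) * Complex.I by push_cast; ring,
      Complex.norm_exp_ofReal_mul_I]
    simp [abs_of_pos Real.pi_pos]

theorem mFourier_add_single (m : Fin n → ℤ) (θ : UnitAddTorus (Fin n)) (j : Fin n) (t : ℝ) :
    UnitAddTorus.mFourier m (θ + Pi.single j (t : UnitAddCircle)) =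
      UnitAddTorus.mFourier m θ * Complex.exp (2 * Real.pi * Complex.I * m j * t) := by
  have h : UnitAddTorus.mFourier m (θ + Pi.single j (t : UnitAddCircle)) =
      UnitAddTorus.mFourier m θ * UnitAddTorus.mFourier m (Pi.single j (t : UnitAddCircle)) := by
    simp only [UnitAddTorus.mFourier, ContinuousMap.coe_mk, ← Finset.prod_mul_distrib]
    refine Finset.prod_congr rfl fun i _ => ?_
    simp [fourier_apply, smul_add, AddCircle.toCircle_add]
  rw [h]
  congr 1
  simp only [UnitAddTorus.mFourier, ContinuousMap.coe_mk]
  rw [Finset.prod_eq_single j]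
  · simp
  · intro i _ hij
    simp [Pi.single_eq_of_ne hij]
  · simp

theorem partialD_synth (h0 : 0 < ħ) (h : Rapid ħ c) (j : Fin n) :
    partialD j (synth c) = synth fun m => (m j : ℂ) * c m := by
  funext θ
  have h1 := h.poly_mul h0 (IsPoly.coordinate j)
  have hd : HasDerivAt (fun t : ℝ => synth c (θ + Pi.single j (t : UnitAddCircle)))
      (∑' m, c m * (UnitAddTorus.mFourier m θ *
        ((2 * Real.pi * Complex.I * m j) *
          Complex.exp (2 * Real.pi * Complex.I * m j * (0 : ℝ))))) 0 := by
    simp only [synth, mFourier_add_single]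
    refine hasDerivAt_tsum (u := fun m => 2 * Real.pi * ‖(m j : ℂ) * c m‖)
      (g' := fun m (t : ℝ) => c m * (UnitAddTorus.mFourier m θ * ((2 * Real.pi * Complex.I * m j) *
          Complex.exp (2 * Real.pi * Complex.I * m j * t)))) (y₀ := (0 : ℝ))
      ((h1.summable_norm h0).mul_left _) (fun m t => ?_) (fun m t => ?_) ?_ 0
    · have h : HasDerivAt (fun t : ℝ => 2 * Real.pi * Complex.I * m j * (t : ℂ))
          (2 * Real.pi * Complex.I * m j) t := by
        simpa using (Complex.ofRealCLM.hasDerivAt (x := t)).const_mul (2 * Real.pi * Complex.I * m j)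
      have := (h.cexp.const_mul (UnitAddTorus.mFourier m θ)).const_mul (c m)
      rwa [mul_comm (Complex.exp _)] at this
    · have : ‖Complex.exp (2 * Real.pi * Complex.I * m j * t)‖ = 1 := by
        rw [show 2 * (Real.pi : ℂ) * Complex.I * m j * t =
          ((2 * Real.pi * m j * t : ℝ) : ℂ) * Complex.I by push_cast; ring,
          Complex.norm_exp_ofReal_mul_I]
      simp only [norm_mul, norm_mFourier_apply, this]
      simp [abs_of_pos Real.pi_pos]
      exact le_of_eq (by ring)
    · simpa using summable_synth (h.summable_norm h0) θ
  rw [partialD, hd.deriv, synth, ← tsum_mul_left]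
  refine tsum_congr fun m => ?_
  have hpi : (Real.pi : ℂ) ≠ 0 := by exact_mod_cast Real.pi_ne_zero
  simp only [Complex.ofReal_zero, mul_zero, Complex.exp_zero, mul_one]
  field_simp

end Synth

/-! ### Fourier coefficients -/

/-- The Fourier coefficient `∫ e^{-2πi m·θ} f(θ) dθ`. -/
def coef {n : ℕ} (f : UnitAddTorus (Fin n) → ℂ) (m : Fin n → ℤ) : ℂ :=
  ∫ θ, UnitAddTorus.mFourier (-m) θ * f θ ∂(torusMeasure n)

section Coef

variable {n : ℕ} {ħ : ℝ} {c : (Fin n → ℤ) → ℂ} {f : UnitAddTorus (Fin n) → ℂ}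

theorem integrable_of_continuous (hf : Continuous f) : Integrable f (torusMeasure n) :=
  hf.integrable_of_hasCompactSupport (HasCompactSupport.of_compactSpace f)

theorem exists_norm_le_of_continuous (hf : Continuous f) : ∃ C : ℝ, ∀ θ, ‖f θ‖ ≤ C := by
  obtain ⟨C, hC⟩ := isCompact_univ.exists_bound_of_continuousOn hf.continuousOn
  exact ⟨C, fun θ => hC θ (Set.mem_univ θ)⟩

theorem norm_coef_le {C : ℝ} (h : ∀ θ, ‖f θ‖ ≤ C) (m : Fin n → ℤ) : ‖coef f m‖ ≤ C := by
  have := norm_integral_le_of_norm_le_const (μ := torusMeasure n) (C := C)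
    (f := fun θ => UnitAddTorus.mFourier (-m) θ * f θ)
    (Filter.Eventually.of_forall fun θ => by simpa [norm_mFourier_apply] using h θ)
  simpa [coef] using this

theorem integral_mFourier (m : Fin n → ℤ) :
    ∫ θ, UnitAddTorus.mFourier m θ ∂(torusMeasure n) = if m = 0 then 1 else 0 := by
  have h := orthonormal_iff_ite.1 (UnitAddTorus.orthonormal_mFourier (d := Fin n)) 0 m
  rw [UnitAddTorus.mFourierLp, UnitAddTorus.mFourierLp, ContinuousMap.inner_toLp] at h
  simp only [UnitAddTorus.mFourier_zero, eq_comm, ContinuousMap.one_apply, map_one, mul_one] at h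
  exact h.symm

theorem coef_synth (h : Summable fun m => ‖c m‖) : coef (synth c) = c := by
  funext l
  have h1 : ∀ θ, UnitAddTorus.mFourier (-l) θ * synth c θ =
      ∑' m, c m * UnitAddTorus.mFourier (m - l) θ := by
    intro θ
    rw [synth, ← tsum_mul_left]
    refine tsum_congr fun m => ?_
    rw [sub_eq_add_neg, UnitAddTorus.mFourier_add]
    ring
  simp only [coef, h1]
  rw [← integral_tsum_of_summable_integral_norm]
  · simp only [integral_const_mul, integral_mFourier, sub_eq_zero]
    simp
  · exact fun m => integrable_of_continuous (by fun_prop)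
  · simpa [norm_mFourier_apply] using h

theorem TorusSmooth.fderiv_apply (hf : TorusSmooth f) (j : Fin n) (x : Fin n → ℝ) :
    HasDerivAt (fun t : ℝ => f ((fun i => (x i : UnitAddCircle)) +
      Pi.single j (t : UnitAddCircle)))
      (fderiv ℝ (fun x : Fin n → ℝ => f fun j => (x j : UnitAddCircle)) x (Pi.single j 1)) 0 := by
  have h1 : HasFDerivAt (fun x : Fin n → ℝ => f fun j => (x j : UnitAddCircle))
      (fderiv ℝ (fun x : Fin n → ℝ => f fun j => (x j : UnitAddCircle)) x)
      (x + (0 : ℝ) • Pi.single j (1 : ℝ)) := by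
    simpa using ((ContDiff.differentiable hf (by simp)) x).hasFDerivAt
  have h2 : HasDerivAt (fun t : ℝ => x + t • (Pi.single j (1 : ℝ) : Fin n → ℝ))
      (Pi.single j 1) 0 := by
    simpa using ((hasDerivAt_id (0 : ℝ)).smul_const (Pi.single j (1 : ℝ) : Fin n → ℝ)).const_add x
  have h3 := h1.comp_hasDerivAt (0 : ℝ) h2
  refine h3.congr_of_eventuallyEq (Filter.Eventually.of_forall fun t => ?_)
  change f _ = f _
  congr 1
  funext i
  rcases eq_or_ne i j with rfl | hij
  · simp
  · simp [hij]

theorem TorusSmooth.partialD (hf : TorusSmooth f) (j : Fin n) :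
    TorusSmooth (HLattice.partialD j f) := by
  have h : (fun x : Fin n → ℝ => HLattice.partialD j f fun j => (x j : UnitAddCircle)) =
      fun x => (2 * Real.pi * Complex.I)⁻¹ *
        fderiv ℝ (fun x : Fin n → ℝ => f fun j => (x j : UnitAddCircle)) x (Pi.single j 1) := by
    funext x
    rw [HLattice.partialD, (hf.fderiv_apply j x).deriv]
  rw [TorusSmooth, h]
  exact contDiff_const.mul ((ContDiff.fderiv_right hf (by simp)).clm_apply contDiff_const)

/-- Translating along the j-th circle moves the derivative at t to one at 0, and every point of the
torus lifts to ℝⁿ. -/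
theorem TorusSmooth.hasDerivAt (hf : TorusSmooth f) (j : Fin n) (θ : UnitAddTorus (Fin n))
    (t : ℝ) : HasDerivAt (fun t : ℝ => f (θ + Pi.single j (t : UnitAddCircle)))
      (2 * Real.pi * Complex.I * HLattice.partialD j f (θ + Pi.single j (t : UnitAddCircle))) t := by
  have key : ∀ θ : UnitAddTorus (Fin n),
      HasDerivAt (fun t : ℝ => f (θ + Pi.single j (t : UnitAddCircle)))
        (2 * Real.pi * Complex.I * HLattice.partialD j f θ) 0 := by
    intro θ
    obtain ⟨x, rfl⟩ : ∃ x : Fin n → ℝ, (fun i => (x i : UnitAddCircle)) = θ := by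
      choose x hx using fun i => QuotientAddGroup.mk_surjective (θ i)
      exact ⟨x, funext hx⟩
    have h := hf.fderiv_apply j x
    rw [HLattice.partialD, h.deriv, mul_inv_cancel_left₀ Complex.two_pi_I_ne_zero]
    exact h
  have h := key (θ + Pi.single j (t : UnitAddCircle))
  rw [← sub_self t] at h
  refine (h.comp_sub_const t t).congr_of_eventuallyEq (Filter.Eventually.of_forall fun s => ?_)
  change f _ = f _
  rw [add_assoc, ← Pi.single_add, ← AddCircle.coe_add, add_sub_cancel]

/-- Translation invariance replaces integration by parts: shifting f by t in direction j multiplies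
its coefficient by e^{2πi m_j t}, and both sides are differentiated at t = 0. -/
theorem coef_partialD (hf : TorusSmooth f) (j : Fin n) (m : Fin n → ℤ) :
    coef (partialD j f) m = m j * coef f m := by
  have hfc := hf.continuous
  have hdc := (hf.partialD j).continuous
  obtain ⟨C, hC⟩ := exists_norm_le_of_continuous hdc
  have h1 : HasDerivAt (fun t : ℝ => ∫ θ, UnitAddTorus.mFourier (-m) θ *
      f (θ + Pi.single j (t : UnitAddCircle)) ∂(torusMeasure n))
      (∫ θ, UnitAddTorus.mFourier (-m) θ * (2 * Real.pi * Complex.I * partialD j f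
        (θ + Pi.single j ((0 : ℝ) : UnitAddCircle))) ∂(torusMeasure n)) 0 := by
    have e1 : ∀ t : ℝ, Continuous fun θ => UnitAddTorus.mFourier (-m) θ *
        f (θ + Pi.single j (t : UnitAddCircle)) := fun t => by fun_prop
    have e2 : Continuous fun θ => UnitAddTorus.mFourier (-m) θ * (2 * Real.pi * Complex.I *
        partialD j f (θ + Pi.single j ((0 : ℝ) : UnitAddCircle))) := by fun_prop
    have e3 : ∀ t : ℝ, AEStronglyMeasurable (fun θ => UnitAddTorus.mFourier (-m) θ *
        f (θ + Pi.single j (t : UnitAddCircle))) (torusMeasure n) :=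
      fun t => (e1 t).aestronglyMeasurable
    have e4 := e2.aestronglyMeasurable (μ := torusMeasure n)
    let F : ℝ → UnitAddTorus (Fin n) → ℂ := fun t θ =>
      UnitAddTorus.mFourier (-m) θ * f (θ + Pi.single j (t : UnitAddCircle))
    let F' : ℝ → UnitAddTorus (Fin n) → ℂ := fun t θ => UnitAddTorus.mFourier (-m) θ *
      (2 * Real.pi * Complex.I * partialD j f (θ + Pi.single j (t : UnitAddCircle)))
    have e5 : ∀ t θ, ‖F' t θ‖ ≤ 2 * Real.pi * C := fun t θ => by
      simp only [F', norm_mul, norm_mFourier_apply]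
      have h := mul_le_mul_of_nonneg_left (hC (θ + Pi.single j (t : UnitAddCircle)))
        Real.two_pi_pos.le
      simpa only [one_mul, Complex.norm_I, mul_one, Complex.norm_real, Complex.norm_ofNat,
        Real.norm_of_nonneg Real.pi_pos.le] using h
    have e6 : ∀ t θ, HasDerivAt (fun t => F t θ) (F' t θ) t := fun t θ =>
      (hf.hasDerivAt j θ t).const_mul _
    have e7 : Integrable (F 0) (torusMeasure n) := integrable_of_continuous (e1 0)
    have e8 : Integrable (fun _ : UnitAddTorus (Fin n) => 2 * Real.pi * C) (torusMeasure n) :=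
      integrable_const _
    have := (hasDerivAt_integral_of_dominated_loc_of_deriv_le (μ := torusMeasure n) (𝕜 := ℝ)
      (x₀ := (0 : ℝ)) (F := F) (F' := F') (s := Set.univ) Filter.univ_mem
      (.of_forall e3) e7 e4 (.of_forall fun θ t _ => e5 t θ) e8
      (.of_forall fun θ t _ => e6 t θ)).2
    exact this
  have h2 : ∀ t : ℝ, ∫ θ, UnitAddTorus.mFourier (-m) θ *
      f (θ + Pi.single j (t : UnitAddCircle)) ∂(torusMeasure n) =
      Complex.exp (2 * Real.pi * Complex.I * m j * t) * coef f m := by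
    intro t
    rw [coef, ← integral_const_mul,
      ← integral_add_right_eq_self (μ := torusMeasure n)
        (fun θ => Complex.exp (2 * Real.pi * Complex.I * m j * t) *
          (UnitAddTorus.mFourier (-m) θ * f θ)) (Pi.single j (t : UnitAddCircle))]
    refine integral_congr_ae (Filter.Eventually.of_forall fun θ => ?_)
    simp only [mFourier_add_single]
    have : Complex.exp (2 * Real.pi * Complex.I * m j * t) *
        Complex.exp (2 * Real.pi * Complex.I * ((-m) j : ℤ) * t) = 1 := by
      rw [← Complex.exp_add, ← Complex.exp_zero]
      congr 1
      simp
    linear_combination (-UnitAddTorus.mFourier (-m) θ * f (θ + Pi.single j (t : UnitAddCircle))) *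
      this
  have h3 : HasDerivAt (fun t : ℝ => 2 * Real.pi * Complex.I * m j * (t : ℂ))
      (2 * Real.pi * Complex.I * m j) 0 := by
    simpa using (Complex.ofRealCLM.hasDerivAt (x := 0)).const_mul (2 * Real.pi * Complex.I * m j)
  have h4 := h1.unique ((h3.cexp.mul_const (coef f m)).congr_of_eventuallyEq
    (Filter.Eventually.of_forall h2))
  have h5 : ∫ θ, UnitAddTorus.mFourier (-m) θ * (2 * Real.pi * Complex.I * partialD j f
        (θ + Pi.single j ((0 : ℝ) : UnitAddCircle))) ∂(torusMeasure n) =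
      2 * Real.pi * Complex.I * coef (partialD j f) m := by
    rw [coef, ← integral_const_mul]
    refine integral_congr_ae (Filter.Eventually.of_forall fun θ => ?_)
    simp
    ring
  rw [h5] at h4
  refine mul_left_cancel₀ Complex.two_pi_I_ne_zero (h4.trans ?_)
  simp
  ring

/-- Each coordinate factor of p is traded for a derivative of f, so the induction has to range over
all smooth f. -/
theorem exists_norm_poly_mul_coef_le {d : ℕ} {p : (Fin n → ℤ) → ℂ} (hp : IsPoly d p)
    (hf : TorusSmooth f) : ∃ C : ℝ, ∀ m, ‖p m * coef f m‖ ≤ C := by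
  induction hp generalizing f with
  | const d a =>
    obtain ⟨C, hC⟩ := exists_norm_le_of_continuous hf.continuous
    refine ⟨‖a‖ * C, fun m => ?_⟩
    rw [norm_mul]
    exact mul_le_mul_of_nonneg_left (norm_coef_le hC m) (norm_nonneg a)
  | @coord d p j _ ih =>
    obtain ⟨C, hC⟩ := ih (hf.partialD j)
    refine ⟨C, fun m => (le_of_eq ?_).trans (hC m)⟩
    rw [coef_partialD hf]
    congr 1
    ring
  | add _ _ ih1 ih2 =>
    obtain ⟨C, hC⟩ := ih1 hf
    obtain ⟨D, hD⟩ := ih2 hf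
    refine ⟨C + D, fun m => ?_⟩
    rw [add_mul]
    exact (norm_add_le _ _).trans (add_le_add (hC m) (hD m))

/-- A weighted bound on a sequence follows from the bound on its product with a polynomial. -/
theorem norm_le_of_poly {C : ℝ} {N : ℕ} {p : (Fin n → ℤ) → ℂ} {m : Fin n → ℤ}
    (hp : wt ħ m ^ ((2 * N : ℕ) : ℝ) ≤ ‖p m‖) (h : ‖p m * c m‖ ≤ C) :
    ‖c m‖ ≤ C * wt ħ m ^ (-((2 * N : ℕ) : ℝ)) := by
  rw [Real.rpow_neg (wt_pos m).le, ← div_eq_mul_inv, le_div_iff₀ (wt_rpow_pos m _), mul_comm]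
  rw [norm_mul] at h
  exact (mul_le_mul_of_nonneg_right hp (norm_nonneg _)).trans h

theorem TorusSmooth.rapid_coef (ħ : ℝ) (hf : TorusSmooth f) : Rapid ħ (coef f) := fun N => by
  obtain ⟨p, hp, hb⟩ := exists_isPoly_wt_le (n := n) ħ N
  obtain ⟨C, hC⟩ := exists_norm_poly_mul_coef_le hp hf
  refine ⟨C, fun m => (norm_le_of_poly (hb m) (hC m)).trans ?_⟩
  refine mul_le_mul_of_nonneg_left (wt_rpow_mono m ?_) ((norm_nonneg _).trans (hC m))
  push_cast
  linarith [Nat.cast_nonneg (α := ℝ) N]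

/-- Together with `coef_synth` this lets symbols be handled entirely through their coefficients. -/
theorem TorusSmooth.synth_coef (hf : TorusSmooth f) : synth (coef f) = f := by
  funext θ
  have h : Summable (UnitAddTorus.mFourierCoeff (d := Fin n)
      ((⟨f, hf.continuous⟩ : C(UnitAddTorus (Fin n), ℂ)) : UnitAddTorus (Fin n) → ℂ)) :=
    ((hf.rapid_coef 1).summable_norm one_pos).of_norm
  exact (UnitAddTorus.hasSum_mFourier_series_apply_of_summable h θ).tsum_eq

end Coef

/-! ### Iterated difference operators -/

section FoldIterate

variable {ι X : Type*} {f : ι → X → X}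

theorem foldr_iterate_apply_comm (hf : ∀ i j, Function.Commute (f i) (f j)) (α : ι → ℕ)
    (L : List ι) (i : ι) (x : X) :
    L.foldr (fun j h => (f j)^[α j] h) (f i x) = f i (L.foldr (fun j h => (f j)^[α j] h) x) := by
  induction L with
  | nil => rfl
  | cons a L ih =>
    simp only [List.foldr_cons, ih]
    exact ((hf a i).iterate_left (α a)).eq _

theorem foldr_iterate_iterate_comm (hf : ∀ i j, Function.Commute (f i) (f j)) (α : ι → ℕ)
    (L : List ι) (i : ι) (b : ℕ) (x : X) :
    L.foldr (fun j h => (f j)^[α j] h) ((f i)^[b] x) =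
      (f i)^[b] (L.foldr (fun j h => (f j)^[α j] h) x) := by
  induction b with
  | zero => rfl
  | succ b ih => rw [Function.iterate_succ_apply', foldr_iterate_apply_comm hf, ih,
      Function.iterate_succ_apply']

/-- The law of exponents Δ^α Δ^β = Δ^{α+β}, abstracted to any commuting family composed in list
order. -/
theorem foldr_iterate_foldr_iterate (hf : ∀ i j, Function.Commute (f i) (f j)) (α β : ι → ℕ)
    (L : List ι) (x : X) :
    L.foldr (fun j h => (f j)^[α j] h) (L.foldr (fun j h => (f j)^[β j] h) x) =
      L.foldr (fun j h => (f j)^[(α + β) j] h) x := by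
  induction L with
  | nil => rfl
  | cons a L ih =>
    simp only [List.foldr_cons]
    rw [foldr_iterate_iterate_comm hf, ih, ← Function.iterate_add_apply, Pi.add_apply]

theorem foldr_iterate_single [DecidableEq ι] (i : ι) {L : List ι} (hL : L.Nodup) (x : X) :
    L.foldr (fun j h => (f j)^[(Pi.single i 1 : ι → ℕ) j] h) x = if i ∈ L then f i x else x := by
  induction L with
  | nil => rfl
  | cons a L ih =>
    rw [List.nodup_cons] at hL
    rw [List.foldr_cons, ih hL.2]
    rcases eq_or_ne i a with rfl | h
    · simp [hL.1]
    · simp [h]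

end FoldIterate

section Mdiff

variable {n : ℕ} {E E' : Type*} [AddCommGroup E] [Module ℝ E] [AddCommGroup E'] [Module ℝ E']
  {ħ : ℝ}

theorem diff_commute (i j : Fin n) :
    Function.Commute (diff ħ i : ((Fin n → ℤ) → E) → _) (diff ħ j) := by
  intro g
  funext l
  simp only [diff, smul_sub, add_right_comm l (Pi.single j 1)]
  abel

theorem mdiff_mdiff (α β : Fin n → ℕ) (g : (Fin n → ℤ) → E) :
    mdiff ħ α (mdiff ħ β g) = mdiff ħ (α + β) g :=
  foldr_iterate_foldr_iterate diff_commute α β _ g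

theorem mdiff_single (j : Fin n) (g : (Fin n → ℤ) → E) :
    mdiff ħ (Pi.single j 1) g = diff ħ j g := by
  exact (foldr_iterate_single (f := diff ħ) j (List.nodup_finRange n) g).trans (by simp)

theorem mdiff_zero (g : (Fin n → ℤ) → E) : mdiff ħ 0 g = g := by
  simp only [mdiff, Pi.zero_apply, Function.iterate_zero, id]
  induction List.finRange n with
  | nil => rfl
  | cons a L ih => exact ih

/-- A relation preserved by all `Δ_{ħ,j}` is preserved by all `Δ_ħ^α`. -/
theorem mdiff_induction {R : ((Fin n → ℤ) → E) → ((Fin n → ℤ) → E') → Prop}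
    (hR : ∀ j g h, R g h → R (diff ħ j g) (diff ħ j h)) (α : Fin n → ℕ)
    {g : (Fin n → ℤ) → E} {h : (Fin n → ℤ) → E'} (hgh : R g h) :
    R (mdiff ħ α g) (mdiff ħ α h) := by
  unfold mdiff
  induction List.finRange n with
  | nil => exact hgh
  | cons a L ih =>
    simp only [List.foldr_cons]
    induction α a with
    | zero => exact ih
    | succ b ihb =>
      rw [Function.iterate_succ_apply', Function.iterate_succ_apply']
      exact hR _ _ _ ihb

theorem map_mdiff (T : E →ₗ[ℝ] E') (α : Fin n → ℕ) (g : (Fin n → ℤ) → E) (k : Fin n → ℤ) :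
    T (mdiff ħ α g k) = mdiff ħ α (fun l => T (g l)) k := by
  refine congrFun (mdiff_induction (R := fun g h => (fun l => T (g l)) = h) ?_ α rfl) k
  rintro j g _ rfl
  funext l
  simp [diff]

theorem mdiff_apply {ι : Type*} (α : Fin n → ℕ) (c : (Fin n → ℤ) → ι → ℂ) (k : Fin n → ℤ)
    (m : ι) : mdiff ħ α c k m = mdiff ħ α (fun l => c l m) k :=
  map_mdiff (LinearMap.proj m : (ι → ℂ) →ₗ[ℝ] ℂ) α c k

theorem mdiff_mul_left {ι : Type*} (α : Fin n → ℕ) (p : ι → ℂ) (c : (Fin n → ℤ) → ι → ℂ)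
    (k : Fin n → ℤ) (m : ι) :
    mdiff ħ α (fun l i => p i * c l i) k m = p m * mdiff ħ α c k m := by
  rw [mdiff_apply, mdiff_apply]
  exact (map_mdiff (LinearMap.mulLeft ℝ (p m)) α (fun l => c l m) k).symm

/-- Both functions are carried along as one function into E × E, so that the relation "sum of the
two components" can be propagated by induction. -/
theorem mdiff_add (α : Fin n → ℕ) (g h : (Fin n → ℤ) → E) :
    mdiff ħ α (fun l => g l + h l) = fun k => mdiff ħ α g k + mdiff ħ α h k := by
  have h1 := mdiff_induction (ħ := ħ) (E := E × E)
    (R := fun a b => b = fun l => (a l).1 + (a l).2) (fun j a b hab => by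
      subst hab
      funext l
      simp only [diff, Prod.smul_fst, Prod.smul_snd, Prod.fst_sub, Prod.snd_sub, ← smul_add]
      congr 1
      abel) α (g := fun l => (g l, h l)) rfl
  rw [h1]
  funext k
  congr 1
  · exact map_mdiff (LinearMap.fst ℝ E E) α _ k
  · exact map_mdiff (LinearMap.snd ℝ E E) α _ k

end Mdiff

/-! ### Symbols in terms of their Fourier coefficients -/

/-- The Fourier multiplier of `D_ħ^{(β)}`. -/
def fallPoly {n : ℕ} (ħ : ℝ) (β : Fin n → ℕ) (m : Fin n → ℤ) : ℂ :=
  ∏ j, ((ħ : ℂ) ^ β j * ∏ l ∈ Finset.range (β j), ((m j : ℂ) - l))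

section FallPoly

variable {n : ℕ} {ħ : ℝ} {c : (Fin n → ℤ) → ℂ}

theorem isPoly_fall (j : Fin n) (b : ℕ) :
    IsPoly b fun m : Fin n → ℤ => ∏ l ∈ Finset.range b, ((m j : ℂ) - l) := by
  have := IsPoly.prod (Finset.range b) (d := fun _ => 1) (p := fun l m => (m j : ℂ) - l)
    fun l _ => by simpa [sub_eq_add_neg] using (IsPoly.coordinate j).add (IsPoly.const 1 (-l : ℂ))
  simpa using this

theorem isPoly_fallPoly (β : Fin n → ℕ) : IsPoly (∑ j, β j) (fallPoly ħ β) :=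
  IsPoly.prod Finset.univ fun j _ => (isPoly_fall j (β j)).const_mul _

theorem fallingD_synth (h0 : 0 < ħ) (h : Rapid ħ c) (j : Fin n) (b : ℕ) :
    fallingD j b (synth c) = synth fun m => (∏ l ∈ Finset.range b, ((m j : ℂ) - l)) * c m := by
  induction b with
  | zero => simp [fallingD]
  | succ b ih =>
    funext θ
    have h1 := h.poly_mul h0 (isPoly_fall j b)
    rw [fallingD, ih, partialD_synth h0 h1]
    beta_reduce
    rw [← synth_const_mul, ← synth_sub h0
      (h1.poly_mul h0 (IsPoly.coordinate j)) (h1.const_mul _)]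
    congr 1
    funext m
    rw [Finset.prod_range_succ]
    ring

theorem mfallingD_synth (h0 : 0 < ħ) (h : Rapid ħ c) (β : Fin n → ℕ) :
    mfallingD ħ β (synth c) = synth fun m => fallPoly ħ β m * c m := by
  have key : ∀ L : List (Fin n),
      Rapid ħ (fun m => (L.map fun j => ((ħ : ℂ) ^ β j *
        ∏ l ∈ Finset.range (β j), ((m j : ℂ) - l))).prod * c m) ∧
      L.foldr (fun j h θ => (ħ : ℂ) ^ β j * fallingD j (β j) h θ) (synth c) =
        synth fun m => (L.map fun j => ((ħ : ℂ) ^ β j *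
          ∏ l ∈ Finset.range (β j), ((m j : ℂ) - l))).prod * c m := by
    intro L
    induction L with
    | nil => simpa using h
    | cons a L ih =>
      have h1 := (ih.1.poly_mul h0 (isPoly_fall a (β a))).const_mul ((ħ : ℂ) ^ β a)
      simp only [List.map_cons, List.prod_cons, List.foldr_cons, ih.2]
      refine ⟨by simpa only [mul_assoc] using h1, ?_⟩
      funext θ
      rw [fallingD_synth h0 ih.1, ← synth_const_mul]
      simp only [mul_assoc]
  rw [mfallingD, (key _).2]
  simp only [fallPoly, Fin.prod_univ_def]

theorem fallPoly_zero (m : Fin n → ℤ) : fallPoly ħ 0 m = 1 := by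
  simp [fallPoly]

theorem fallPoly_add_single (β : Fin n → ℕ) (j : Fin n) (m : Fin n → ℤ) :
    fallPoly ħ (β + Pi.single j 1) m = (ħ : ℂ) * ((m j : ℂ) - β j) * fallPoly ħ β m := by
  let G : Fin n → ℕ → ℂ := fun i b => (ħ : ℂ) ^ b * ∏ l ∈ Finset.range b, ((m i : ℂ) - l)
  change ∏ i, G i ((β + Pi.single j 1 : Fin n → ℕ) i) = _ * ∏ i, G i (β i)
  rw [Fintype.prod_eq_mul_prod_compl j, Fintype.prod_eq_mul_prod_compl j]
  have h1 : ∏ i ∈ ({j} : Finset (Fin n))ᶜ, G i ((β + Pi.single j 1 : Fin n → ℕ) i) =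
      ∏ i ∈ ({j} : Finset (Fin n))ᶜ, G i (β i) := by
    refine Finset.prod_congr rfl fun i hi => ?_
    simp only [Finset.mem_compl, Finset.mem_singleton] at hi
    simp [hi]
  have h2 : G j ((β + Pi.single j 1 : Fin n → ℕ) j) = (ħ : ℂ) * ((m j : ℂ) - β j) * G j (β j) := by
    simp only [G, Pi.add_apply, Pi.single_eq_same, Finset.prod_range_succ, pow_succ]
    ring
  rw [h1, h2]
  ring

/-- Falling factorials span the polynomials with control of degree, since m_j times the multiplier
of β is ħ⁻¹ times that of β + e_j plus β_j times that of β. -/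
theorem isPoly_mem_span (h0 : ħ ≠ 0) {d : ℕ} {p : (Fin n → ℤ) → ℂ} (hp : IsPoly d p) :
    p ∈ Submodule.span ℂ {q | ∃ β : Fin n → ℕ, ∑ j, β j ≤ d ∧ q = fallPoly ħ β} := by
  induction hp with
  | const d a =>
    have : (fun _ => a : (Fin n → ℤ) → ℂ) = a • fallPoly ħ 0 := by
      funext m
      simp [fallPoly_zero]
    rw [this]
    exact Submodule.smul_mem _ _ (Submodule.subset_span ⟨0, by simp, rfl⟩)
  | @coord d p j hq ih =>
    clear hq
    have hm : ∀ (b : ℂ) (q : (Fin n → ℤ) → ℂ), (fun m => (m j : ℂ) * (b • q) m) =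
        b • fun m => (m j : ℂ) * q m := fun b q => by
      funext m
      simp only [Pi.smul_apply, smul_eq_mul]
      ring
    induction ih using Submodule.span_induction with
    | mem q hq =>
      obtain ⟨β, hβ, rfl⟩ := hq
      have h1 : (fun m : Fin n → ℤ => (m j : ℂ) * fallPoly ħ β m) =
          (ħ : ℂ)⁻¹ • fallPoly ħ (β + Pi.single j 1) + (β j : ℂ) • fallPoly ħ β := by
        funext m
        have : (ħ : ℂ) ≠ 0 := by exact_mod_cast h0
        simp only [Pi.add_apply, Pi.smul_apply, smul_eq_mul, fallPoly_add_single]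
        field_simp
        ring
      rw [h1]
      refine Submodule.add_mem _ (Submodule.smul_mem _ _ (Submodule.subset_span ⟨_, ?_, rfl⟩))
        (Submodule.smul_mem _ _ (Submodule.subset_span ⟨β, by omega, rfl⟩))
      simpa [Finset.sum_add_distrib] using hβ
    | zero => simp only [Pi.zero_apply, mul_zero]; exact Submodule.zero_mem _
    | add q r _ _ h1 h2 => simp only [Pi.add_apply, mul_add]; exact Submodule.add_mem _ h1 h2
    | smul b q _ h1 => rw [hm]; exact Submodule.smul_mem _ _ h1
  | add _ _ ih1 ih2 => exact Submodule.add_mem _ ih1 ih2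

end FallPoly

/-- The symbol estimates for `∑_m c(k,m) e^{2πi m·θ}`, with all polynomial Fourier multipliers. -/
structure SymSeq {n : ℕ} (ħ μ ρ δ : ℝ) (c : (Fin n → ℤ) → (Fin n → ℤ) → ℂ) : Prop where
  rapid : ∀ k, Rapid ħ (c k)
  bound : ∀ (α : Fin n → ℕ) (d : ℕ) (p : (Fin n → ℤ) → ℂ), IsPoly d p → ∃ C : ℝ, ∀ k θ,
    ‖synth (fun m => p m * mdiff ħ α c k m) θ‖ ≤
      C * wt ħ k ^ (μ - ρ * ((∑ j, α j : ℕ) : ℝ) + δ * d)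

section SymSeq

variable {n : ℕ} {ħ μ ν ρ δ : ℝ} {c c' : (Fin n → ℤ) → (Fin n → ℤ) → ℂ}

theorem mdiff_rapid_and_synth (h0 : 0 < ħ) (α : Fin n → ℕ) (h : ∀ k, Rapid ħ (c k)) :
    (∀ k, Rapid ħ (mdiff ħ α c k)) ∧
      mdiff ħ α (fun k => synth (c k)) = fun k => synth (mdiff ħ α c k) := by
  refine mdiff_induction (R := fun σ c => (∀ k, Rapid ħ (c k)) ∧ σ = fun k => synth (c k))
    ?_ α ⟨h, rfl⟩
  rintro j _ c ⟨hc, rfl⟩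
  have h1 : ∀ l, diff ħ j c l = fun m => (ħ⁻¹ : ℂ) * (c (l + Pi.single j 1) m - c l m) := by
    intro l
    funext m
    simp [diff]
  refine ⟨fun l => ?_, ?_⟩
  · rw [h1]
    exact ((hc _).sub (hc _)).const_mul _
  · funext l θ
    rw [h1, synth_const_mul, synth_sub h0 (hc _) (hc _)]
    simp [diff]

theorem mdiff_rapid (h0 : 0 < ħ) (α : Fin n → ℕ) (h : ∀ k, Rapid ħ (c k)) (k : Fin n → ℤ) :
    Rapid ħ (mdiff ħ α c k) :=
  (mdiff_rapid_and_synth h0 α h).1 k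

theorem mdiff_synth (h0 : 0 < ħ) (α : Fin n → ℕ) (h : ∀ k, Rapid ħ (c k)) :
    mdiff ħ α (fun k => synth (c k)) = fun k => synth (mdiff ħ α c k) :=
  (mdiff_rapid_and_synth h0 α h).2

/-- The definition bounds only the multipliers of D^(β); linearity extends the bounds to every
polynomial of degree at most d. Lower degrees obey the bound for d because δ ≥ 0. -/
theorem IsSymbol.symSeq (h0 : 0 < ħ) (hδ : 0 ≤ δ) (hr : ∀ k, Rapid ħ (c k))
    (h : IsSymbol ħ μ ρ δ fun k => synth (c k)) : SymSeq ħ μ ρ δ c := by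
  refine ⟨hr, fun α d p hp => ?_⟩
  have hmem := isPoly_mem_span h0.ne' hp
  clear hp
  have key : (∀ k, Rapid ħ fun m => p m * mdiff ħ α c k m) ∧ ∃ C : ℝ, ∀ k θ,
      ‖synth (fun m => p m * mdiff ħ α c k m) θ‖ ≤
        C * wt ħ k ^ (μ - ρ * ((∑ j, α j : ℕ) : ℝ) + δ * d) := by
    induction hmem using Submodule.span_induction with
    | mem q hq =>
      obtain ⟨β, hβ, rfl⟩ := hq
      refine ⟨fun k => (mdiff_rapid h0 α hr k).poly_mul h0 (isPoly_fallPoly β), ?_⟩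
      obtain ⟨C, hC, hb⟩ := h.bound α β
      refine ⟨C, fun k θ => ?_⟩
      have h1 := hb k θ
      rw [mdiff_synth h0 α hr, mfallingD_synth h0 (mdiff_rapid h0 α hr k)] at h1
      refine h1.trans (mul_le_mul_of_nonneg_left (wt_rpow_mono k ?_) hC.le)
      have : δ * ((∑ j, β j : ℕ) : ℝ) ≤ δ * d :=
        mul_le_mul_of_nonneg_left (by exact_mod_cast hβ) hδ
      linarith
    | zero =>
      simp only [Pi.zero_apply, zero_mul, synth_zero]
      exact ⟨fun k => Rapid.zero, 0, by simp⟩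
    | add q r _ _ h1 h2 =>
      obtain ⟨hq, C, hC⟩ := h1
      obtain ⟨hr, D, hD⟩ := h2
      simp only [Pi.add_apply, add_mul]
      refine ⟨fun k => (hq k).add (hr k), C + D, fun k θ => ?_⟩
      rw [synth_add h0 (hq k) (hr k), add_mul]
      exact (norm_add_le _ _).trans (add_le_add (hC k θ) (hD k θ))
    | smul b q _ h1 =>
      obtain ⟨hq, C, hC⟩ := h1
      simp only [Pi.smul_apply, smul_eq_mul, mul_assoc]
      refine ⟨fun k => (hq k).const_mul b, ‖b‖ * C, fun k θ => ?_⟩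
      rw [synth_const_mul, norm_mul, mul_assoc]
      exact mul_le_mul_of_nonneg_left (hC k θ) (norm_nonneg b)
  exact key.2

theorem SymSeq.isSymbol (h0 : 0 < ħ) (h : SymSeq ħ μ ρ δ c) :
    IsSymbol ħ μ ρ δ fun k => synth (c k) := by
  refine ⟨fun k => torusSmooth_synth h0 (h.rapid k), fun α β => ?_⟩
  obtain ⟨C, hC⟩ := h.bound α _ _ (isPoly_fallPoly (ħ := ħ) β)
  refine ⟨|C| + 1, by positivity, fun k θ => ?_⟩
  rw [mdiff_synth h0 α h.rapid, mfallingD_synth h0 (mdiff_rapid h0 α h.rapid k)]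
  refine (hC k θ).trans (mul_le_mul_of_nonneg_right ?_ (wt_rpow_pos k _).le)
  linarith [le_abs_self C]

namespace SymSeq

theorem add (h0 : 0 < ħ) (h : SymSeq ħ μ ρ δ c) (h' : SymSeq ħ μ ρ δ c') :
    SymSeq ħ μ ρ δ fun k m => c k m + c' k m := by
  refine ⟨fun k => (h.rapid k).add (h'.rapid k), fun α d p hp => ?_⟩
  obtain ⟨C, hC⟩ := h.bound α d p hp
  obtain ⟨D, hD⟩ := h'.bound α d p hp
  refine ⟨C + D, fun k θ => ?_⟩
  have h1 : (fun m => p m * mdiff ħ α (fun k m => c k m + c' k m) k m) =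
      fun m => p m * mdiff ħ α c k m + p m * mdiff ħ α c' k m := by
    funext m
    rw [show (fun k m => c k m + c' k m) = fun k => c k + c' k from rfl, mdiff_add]
    exact mul_add _ _ _
  rw [h1, synth_add h0 ((mdiff_rapid h0 α h.rapid k).poly_mul h0 hp)
    ((mdiff_rapid h0 α h'.rapid k).poly_mul h0 hp), add_mul]
  exact (norm_add_le _ _).trans (add_le_add (hC k θ) (hD k θ))

theorem mono (h : SymSeq ħ μ ρ δ c) (hμ : μ ≤ ν) : SymSeq ħ ν ρ δ c := by
  refine ⟨h.rapid, fun α d p hp => ?_⟩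
  obtain ⟨C, hC⟩ := h.bound α d p hp
  refine ⟨C, fun k θ => (hC k θ).trans (mul_le_mul_of_nonneg_left (wt_rpow_mono k ?_) ?_)⟩
  · linarith
  · have := (norm_nonneg _).trans (hC 0 0)
    exact nonneg_of_mul_nonneg_left this (wt_rpow_pos _ _)

theorem poly_mul_mdiff (h0 : 0 < ħ) (h : SymSeq ħ μ ρ δ c) (α : Fin n → ℕ) {d : ℕ}
    {p : (Fin n → ℤ) → ℂ} (hp : IsPoly d p) :
    SymSeq ħ (μ - ρ * ((∑ j, α j : ℕ) : ℝ) + δ * d) ρ δ fun k m => p m * mdiff ħ α c k m := by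
  refine ⟨fun k => (mdiff_rapid h0 α h.rapid k).poly_mul h0 hp, fun γ e q hq => ?_⟩
  obtain ⟨C, hC⟩ := h.bound (γ + α) (e + d) _ (hq.mul hp)
  refine ⟨C, fun k θ => ?_⟩
  have h1 := hC k θ
  simp only [mdiff_mul_left, mdiff_mdiff, ← mul_assoc]
  refine h1.trans_eq ?_
  congr 2
  simp only [Pi.add_apply, Finset.sum_add_distrib]
  push_cast
  ring

theorem zero : SymSeq ħ μ ρ δ (fun _ _ => 0 : (Fin n → ℤ) → (Fin n → ℤ) → ℂ) := by
  refine ⟨fun k => Rapid.zero, fun α d p _ => ⟨0, fun k θ => ?_⟩⟩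
  have h1 := mdiff_mul_left (ħ := ħ) α (0 : (Fin n → ℤ) → ℂ) (fun _ _ => 0) k
  simp only [Pi.zero_apply, zero_mul] at h1
  simp [h1, synth_zero]

theorem sum (h0 : 0 < ħ) {ι : Type*} (s : Finset ι) {f : ι → (Fin n → ℤ) → (Fin n → ℤ) → ℂ}
    (h : ∀ i ∈ s, SymSeq ħ μ ρ δ (f i)) : SymSeq ħ μ ρ δ fun k m => ∑ i ∈ s, f i k m := by
  classical
  induction s using Finset.induction_on with
  | empty => simpa using zero
  | insert a s ha ih =>
    simp only [Finset.sum_insert ha]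
    exact (h a (Finset.mem_insert_self a s)).add h0
      (ih fun i hi => h i (Finset.mem_insert_of_mem hi))

/-- The reason for admitting all polynomial multipliers: conjugation does not send falling
factorials to falling factorials, but it does preserve polynomials of a given degree. -/
theorem conj_neg (h : SymSeq ħ μ ρ δ c) : SymSeq ħ μ ρ δ fun k m => conj (c k (-m)) := by
  refine ⟨fun k => (h.rapid k).conj_neg, fun α d p hp => ?_⟩
  obtain ⟨C, hC⟩ := h.bound α d _ hp.conj_neg
  refine ⟨C, fun k θ => ?_⟩
  have h1 : (fun m => p m * mdiff ħ α (fun k m => conj (c k (-m))) k m) =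
      fun m => conj ((fun m => conj (p (-m)) * mdiff ħ α c k m) (-m)) := by
    funext m
    have h2 := map_mdiff (ħ := ħ) Complex.conjAe.toLinearMap α (fun l => c l (-m)) k
    rw [mdiff_apply, map_mul, mdiff_apply α c]
    simp only [neg_neg, Complex.conj_conj]
    congr 1
    exact h2.symm
  rw [h1]
  exact ((congrArg norm (synth_conj_neg (c := fun m => conj (p (-m)) * mdiff ħ α c k m) θ)).trans
    (RCLike.norm_conj _)).trans_le (hC k θ)

/-- Decay of the Fourier coefficients of a symbol. -/
theorem norm_mdiff_le (h0 : 0 < ħ) (h : SymSeq ħ μ ρ δ c) (N M : ℕ) :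
    ∃ C : ℝ, 0 ≤ C ∧ ∀ α ∈ Finset.piAntidiag Finset.univ N, ∀ k m, ‖mdiff ħ α c k m‖ ≤
      C * wt ħ k ^ (μ - ρ * N + δ * (2 * M : ℕ)) * wt ħ m ^ (-((2 * M : ℕ) : ℝ)) := by
  -- Decay in m is bought by bounding p·c in place of c. The degree 2M of p explains both the even
  -- exponent and the loss of 2Mδ in k.
  obtain ⟨p, hp, hb⟩ := exists_isPoly_wt_le (n := n) ħ M
  choose C hC using fun α => h.bound α _ p hp
  refine ⟨∑ α ∈ Finset.piAntidiag Finset.univ N, |C α|,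
    Finset.sum_nonneg fun _ _ => abs_nonneg _, fun α hα k m => ?_⟩
  have h1 := norm_coef_le (hC α k) m
  rw [coef_synth (((mdiff_rapid h0 α h.rapid k).poly_mul h0 hp).summable_norm h0)] at h1
  refine (norm_le_of_poly (hb m) h1).trans ?_
  rw [(Finset.mem_piAntidiag.1 hα).1]
  gcongr
  · exact (wt_rpow_pos m _).le
  · exact (wt_rpow_pos k _).le
  · exact (le_abs_self _).trans
      (Finset.single_le_sum (f := fun α => |C α|) (fun _ _ => abs_nonneg _) hα)

end SymSeq

end SymSeq

/-! ### The discrete Taylor formula -/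

/-- The coefficient `(1/α!) ħ^{|α|} m (m - 1) ⋯` of `Δ_ħ^α` in the discrete Taylor formula. -/
def taylorCoeff {n : ℕ} (ħ : ℝ) (α : Fin n → ℕ) (m : Fin n → ℤ) : ℂ :=
  ((∏ j, (α j).factorial : ℕ) : ℂ)⁻¹ * fallPoly ħ α m

/-- The discrete Taylor polynomial of order `N` of `g` at `k`. -/
def taylor {n : ℕ} (ħ : ℝ) (N : ℕ) (g : (Fin n → ℤ) → ℂ) (k m : Fin n → ℤ) : ℂ :=
  ∑ d ∈ Finset.range N, ∑ α ∈ Finset.piAntidiag Finset.univ d,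
    taylorCoeff ħ α m * mdiff ħ α g k

section Taylor

variable {n : ℕ} {ħ : ℝ}

theorem isPoly_taylorCoeff (α : Fin n → ℕ) : IsPoly (∑ j, α j) (taylorCoeff ħ α) :=
  (isPoly_fallPoly α).const_mul _

theorem fallPoly_add_single_add_single (β : Fin n → ℕ) (j : Fin n) (m : Fin n → ℤ) :
    fallPoly ħ (β + Pi.single j 1) (m + Pi.single j 1) =
      (ħ : ℂ) * ((m j : ℂ) + 1) * fallPoly ħ β m := by
  let G : Fin n → ℕ → ℤ → ℂ := fun i b x => (ħ : ℂ) ^ b * ∏ l ∈ Finset.range b, ((x : ℂ) - l)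
  change ∏ i, G i ((β + Pi.single j 1 : Fin n → ℕ) i) ((m + Pi.single j 1 : Fin n → ℤ) i) =
    _ * ∏ i, G i (β i) (m i)
  rw [Fintype.prod_eq_mul_prod_compl j, Fintype.prod_eq_mul_prod_compl j]
  have h1 : ∏ i ∈ ({j} : Finset (Fin n))ᶜ,
      G i ((β + Pi.single j 1 : Fin n → ℕ) i) ((m + Pi.single j 1 : Fin n → ℤ) i) =
      ∏ i ∈ ({j} : Finset (Fin n))ᶜ, G i (β i) (m i) := by
    refine Finset.prod_congr rfl fun i hi => ?_
    simp only [Finset.mem_compl, Finset.mem_singleton] at hi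
    simp [hi]
  have h2 : G j ((β + Pi.single j 1 : Fin n → ℕ) j) ((m + Pi.single j 1 : Fin n → ℤ) j) =
      (ħ : ℂ) * ((m j : ℂ) + 1) * G j (β j) (m j) := by
    simp only [G, Pi.add_apply, Pi.single_eq_same, Finset.prod_range_succ', pow_succ]
    push_cast
    simp only [add_sub_add_right_eq_sub]
    ring
  rw [h1, h2]
  ring

theorem fallPoly_add_single_of_eq_zero {β : Fin n → ℕ} {j : Fin n} (hj : β j = 0)
    (m : Fin n → ℤ) : fallPoly ħ β (m + Pi.single j 1) = fallPoly ħ β m := by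
  refine Finset.prod_congr rfl fun i _ => ?_
  rcases eq_or_ne i j with rfl | h
  · simp [hj]
  · simp [h]

theorem fallPoly_zero_right {β : Fin n → ℕ} (hβ : β ≠ 0) :
    fallPoly ħ β (0 : Fin n → ℤ) = 0 := by
  obtain ⟨j, hj⟩ := Function.ne_iff.1 hβ
  refine Finset.prod_eq_zero (Finset.mem_univ j) ?_
  rw [Finset.prod_eq_zero (Finset.mem_range.2 (Nat.pos_of_ne_zero hj)) (by simp), mul_zero]

theorem taylorCoeff_zero (m : Fin n → ℤ) : taylorCoeff ħ 0 m = 1 := by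
  simp [taylorCoeff, fallPoly_zero]

/-- The discrete form of (x^{b+1}/(b+1)!)' = x^b/b!; equivalently, Pascal's rule. -/
theorem taylorCoeff_diff (β : Fin n → ℕ) (j : Fin n) (m : Fin n → ℤ) :
    taylorCoeff ħ (β + Pi.single j 1) (m + Pi.single j 1) -
      taylorCoeff ħ (β + Pi.single j 1) m = (ħ : ℂ) * taylorCoeff ħ β m := by
  have h1 : ∏ i, ((β + Pi.single j 1 : Fin n → ℕ) i).factorial =
      (β j + 1) * ∏ i, (β i).factorial := by
    rw [Fintype.prod_eq_mul_prod_compl j, Fintype.prod_eq_mul_prod_compl j]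
    have : ∏ i ∈ ({j} : Finset (Fin n))ᶜ, ((β + Pi.single j 1 : Fin n → ℕ) i).factorial =
        ∏ i ∈ ({j} : Finset (Fin n))ᶜ, (β i).factorial := by
      refine Finset.prod_congr rfl fun i hi => ?_
      simp only [Finset.mem_compl, Finset.mem_singleton] at hi
      simp [hi]
    rw [this]
    simp [Nat.factorial_succ, mul_assoc]
  have h2 : ((∏ i, (β i).factorial : ℕ) : ℂ) ≠ 0 := by
    exact_mod_cast (Finset.prod_pos fun i _ => Nat.factorial_pos (β i)).ne'
  have h3 : ((β j : ℂ) + 1) ≠ 0 := by exact_mod_cast Nat.succ_ne_zero (β j)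
  rw [taylorCoeff, taylorCoeff, taylorCoeff, fallPoly_add_single_add_single, fallPoly_add_single,
    h1, Nat.cast_mul, Nat.cast_add, Nat.cast_one]
  field_simp
  ring

theorem sum_piAntidiag_succ (j : Fin n) (d : ℕ) {f : (Fin n → ℕ) → ℂ}
    (hf : ∀ α, α j = 0 → f α = 0) :
    ∑ α ∈ Finset.piAntidiag Finset.univ (d + 1), f α =
      ∑ α ∈ Finset.piAntidiag Finset.univ d, f (α + Pi.single j 1) := by
  symm
  refine Finset.sum_of_injOn (fun α => α + Pi.single j 1) ?_ ?_ ?_ fun _ _ => rfl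
  · exact fun α _ β _ h => add_right_cancel h
  · intro α hα
    simp only [Finset.mem_coe, Finset.mem_piAntidiag] at hα ⊢
    simpa [Finset.sum_add_distrib] using hα
  · intro α hα hα'
    refine hf α (by_contra fun hj => hα' ⟨α - Pi.single j 1, ?_, ?_⟩)
    · have h1 : α - Pi.single j 1 + Pi.single j 1 = α := by
        funext i
        rcases eq_or_ne i j with rfl | h
        · simp; omega
        · simp [h]
      simp only [Finset.mem_coe, Finset.mem_piAntidiag, Finset.mem_univ, implies_true,
        and_true] at hα ⊢
      rw [← h1] at hα
      simpa [Finset.sum_add_distrib] using hα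
    · funext i
      rcases eq_or_ne i j with rfl | h
      · simp; omega
      · simp [h]

/-- A unit step in m turns the Taylor polynomial of g into the one of Δ_j g of one order less, which
drives the induction for the remainder. The constant term cancels. -/
theorem taylor_succ_add_single (N : ℕ) (g : (Fin n → ℤ) → ℂ) (k m : Fin n → ℤ) (j : Fin n) :
    taylor ħ (N + 1) g k (m + Pi.single j 1) - taylor ħ (N + 1) g k m =
      (ħ : ℂ) * taylor ħ N (diff ħ j g) k m := by
  simp only [taylor, Finset.sum_range_succ' _ N, Finset.mul_sum]
  rw [add_sub_add_comm, ← Finset.sum_sub_distrib]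
  have h0 : ∀ m' : Fin n → ℤ, ∑ α ∈ Finset.piAntidiag (Finset.univ : Finset (Fin n)) 0,
      taylorCoeff ħ α m' * mdiff ħ α g k = g k := fun m' => by
    simp [taylorCoeff_zero, mdiff_zero]
  rw [h0, h0, sub_self, add_zero]
  refine Finset.sum_congr rfl fun d _ => ?_
  rw [← Finset.sum_sub_distrib, sum_piAntidiag_succ j d]
  · refine Finset.sum_congr rfl fun α _ => ?_
    rw [← sub_mul, taylorCoeff_diff, ← mdiff_single, mdiff_mdiff, mul_assoc]
  · intro α hα
    simp [taylorCoeff, fallPoly_add_single_of_eq_zero hα]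

theorem taylor_succ_zero (N : ℕ) (g : (Fin n → ℤ) → ℂ) (k : Fin n → ℤ) :
    taylor ħ (N + 1) g k 0 = g k := by
  rw [taylor, Finset.sum_range_succ', Finset.sum_eq_zero]
  · simp [taylorCoeff_zero, mdiff_zero]
  · intro d _
    refine Finset.sum_eq_zero fun α hα => ?_
    have : α ≠ 0 := by
      rintro rfl
      simp at hα
    rw [taylorCoeff, fallPoly_zero_right this]
    simp

/-- A nonzero lattice point has a neighbour nearer to 0, in direction -e_j or +e_j according to the
sign of a nonzero coordinate; differences are one-sided, hence the two forms. -/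
theorem exists_size_step {m : Fin n → ℤ} {s : ℕ} (hm : size m = s + 1) :
    ∃ j, (∃ m', size m' = s ∧ m = m' + Pi.single j 1) ∨ size (m + Pi.single j 1) = s := by
  have hne : ∃ j, m j ≠ 0 := by
    by_contra! h
    simp [size, h] at hm
  obtain ⟨j, hj⟩ := hne
  have key : ∀ x : ℤ, size (m + Pi.single j x) + (m j).natAbs = size m + (m j + x).natAbs := by
    intro x
    rw [size, size, Fintype.sum_eq_add_sum_compl j, Fintype.sum_eq_add_sum_compl j]
    have : ∑ i ∈ ({j} : Finset (Fin n))ᶜ, ((m + Pi.single j x : Fin n → ℤ) i).natAbs =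
        ∑ i ∈ ({j} : Finset (Fin n))ᶜ, (m i).natAbs := by
      refine Finset.sum_congr rfl fun i hi => ?_
      simp only [Finset.mem_compl, Finset.mem_singleton] at hi
      simp [hi]
    rw [this]
    simp
    ring
  refine ⟨j, ?_⟩
  rcases lt_or_gt_of_ne hj with h | h
  · right
    have := key 1
    omega
  · left
    refine ⟨m + Pi.single j (-1), ?_, ?_⟩
    · have := key (-1)
      omega
    · rw [add_assoc, ← Pi.single_add]
      simp

/-- The remainder estimate in the discrete Taylor formula. -/
theorem norm_sub_taylor_le (h0 : 0 < ħ) (k : Fin n → ℤ) (S N : ℕ) {B : ℝ} (hB : 0 ≤ B) {g : (Fin n → ℤ) → ℂ}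
    (hg : ∀ α ∈ Finset.piAntidiag Finset.univ N, ∀ y, size y ≤ S → ‖mdiff ħ α g (k + y)‖ ≤ B)
    {m : Fin n → ℤ} (hm : size m ≤ S) :
    ‖g (k + m) - taylor ħ N g k m‖ ≤ B * (ħ * S) ^ N := by
  induction N generalizing g m with
  | zero =>
    have := hg 0 (by simp) m hm
    simpa [taylor, mdiff_zero] using this
  | succ N ih =>
    have h1 : ∀ j m, size m ≤ S →
        ‖diff ħ j g (k + m) - taylor ħ N (diff ħ j g) k m‖ ≤ B * (ħ * S) ^ N := by
      intro j m hm
      refine ih (fun α hα y hy => ?_) hm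
      rw [← mdiff_single, mdiff_mdiff]
      refine hg _ ?_ y hy
      simpa [Finset.sum_add_distrib] using hα
    have hB' : 0 ≤ B * (ħ * S) ^ N := by positivity
    have hstep : ∀ (m : Fin n → ℤ) j, g (k + (m + Pi.single j 1)) -
        taylor ħ (N + 1) g k (m + Pi.single j 1) = (g (k + m) - taylor ħ (N + 1) g k m) +
          (ħ : ℂ) * (diff ħ j g (k + m) - taylor ħ N (diff ħ j g) k m) := by
      intro m j
      have e1 := taylor_succ_add_single (ħ := ħ) N g k m j
      have e2 : (ħ : ℂ) * diff ħ j g (k + m) = g (k + (m + Pi.single j 1)) - g (k + m) := by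
        have : (ħ : ℂ) ≠ 0 := by exact_mod_cast h0.ne'
        simp [diff, add_assoc, mul_inv_cancel_left₀ this]
      rw [mul_sub, e2, ← e1]
      ring
    -- Telescoping along a path of unit steps between 0 and m inside the ℓ¹ ball of radius S: the
    -- remainder vanishes at 0, and each step adds at most ħ times the lower-order remainder of some
    -- Δ_j g.
    have key : ∀ s (m : Fin n → ℤ), size m = s → s ≤ S →
        ‖g (k + m) - taylor ħ (N + 1) g k m‖ ≤ ħ * (B * (ħ * S) ^ N) * s := by
      intro s
      induction s with
      | zero =>
        intro m hm _
        have : m = 0 := by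
          funext j
          have := Finset.sum_eq_zero_iff.1 hm j (Finset.mem_univ j)
          simpa using this
        subst this
        simp [taylor_succ_zero]
      | succ s ihs =>
        intro m hm hs
        obtain ⟨j, ⟨m', hm', rfl⟩ | hj⟩ := exists_size_step hm
        · rw [hstep]
          refine (norm_add_le _ _).trans ?_
          rw [norm_mul, Complex.norm_real, Real.norm_of_nonneg h0.le]
          push_cast
          have e1 := ihs m' hm' (by omega)
          have e2 := mul_le_mul_of_nonneg_left (h1 j m' (by omega)) h0.le
          linarith
        · have e0 : g (k + m) - taylor ħ (N + 1) g k m = g (k + (m + Pi.single j 1)) -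
            taylor ħ (N + 1) g k (m + Pi.single j 1) -
              (ħ : ℂ) * (diff ħ j g (k + m) - taylor ħ N (diff ħ j g) k m) := by
            rw [hstep]
            ring
          rw [e0]
          refine (norm_sub_le _ _).trans ?_
          rw [norm_mul, Complex.norm_real, Real.norm_of_nonneg h0.le]
          push_cast
          have e1 := ihs _ hj (by omega)
          have e2 := mul_le_mul_of_nonneg_left (h1 j m (by omega)) h0.le
          linarith
    refine (key _ m rfl hm).trans ?_
    calc ħ * (B * (ħ * S) ^ N) * size m ≤ ħ * (B * (ħ * S) ^ N) * S := by gcongr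
      _ = B * (ħ * S) ^ (N + 1) := by ring

end Taylor

/-! ### The expansion of `c(k + m, m)` -/

/-- The difference of `c(k + m, m)` and its discrete Taylor polynomial of order `N`. -/
def taylorRem {n : ℕ} (ħ : ℝ) (c : (Fin n → ℤ) → (Fin n → ℤ) → ℂ) (N : ℕ) (k m : Fin n → ℤ) : ℂ :=
  c (k + m) m - taylor ħ N (fun l => c l m) k m

section TaylorRem

variable {n : ℕ} {ħ μ ρ δ : ℝ} {c : (Fin n → ℤ) → (Fin n → ℤ) → ℂ}

theorem SymSeq.norm_taylorRem_le (h0 : 0 < ħ) (h : SymSeq ħ μ ρ δ c) (N M : ℕ) :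
    ∃ C : ℝ, 0 ≤ C ∧ ∀ k m, ‖taylorRem ħ c N k m‖ ≤
      C * wt ħ k ^ (μ - ρ * N + δ * (2 * M : ℕ)) *
        wt ħ m ^ (N - ((2 * M : ℕ) : ℝ) + |μ - ρ * N + δ * (2 * M : ℕ)|) := by
  obtain ⟨C, hC, hb⟩ := h.norm_mdiff_le h0 N M
  set s := μ - ρ * N + δ * (2 * M : ℕ) with hs
  -- The factor (1 + n)^|s| is the cost of Peetre's inequality on the ℓ¹ ball of m; n^N comes from
  -- (ħ · size m)^N.
  refine ⟨C * (1 + n) ^ |s| * n ^ N, by positivity, fun k m => ?_⟩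
  have hk := wt_rpow_pos (ħ := ħ) k s
  have hm := wt_pos (ħ := ħ) m
  have h1 := norm_sub_taylor_le h0 k (size m) N (g := fun l => c l m) (m := m)
    (B := C * (wt ħ k ^ s * ((1 + n) * wt ħ m) ^ |s|) * wt ħ m ^ (-((2 * M : ℕ) : ℝ)))
    (by positivity) (fun α hα y hy => by
      rw [← mdiff_apply]
      refine (hb α hα (k + y) m).trans ?_
      refine mul_le_mul_of_nonneg_right (mul_le_mul_of_nonneg_left ?_ hC) (wt_rpow_pos m _).le
      refine (wt_add_rpow_le k y s).trans (mul_le_mul_of_nonneg_left ?_ hk.le)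
      exact Real.rpow_le_rpow (wt_pos y).le (wt_le_of_size_le h0 hy) (abs_nonneg s)) le_rfl
  refine h1.trans ?_
  have h2 : (ħ * size m) ^ N ≤ (n * wt ħ m) ^ N :=
    pow_le_pow_left₀ (by positivity) (mul_size_le h0 m) N
  refine (mul_le_mul_of_nonneg_left h2 (by positivity)).trans_eq ?_
  rw [Real.mul_rpow (by positivity) hm.le, mul_pow, Real.rpow_add hm, sub_eq_add_neg,
    Real.rpow_add hm, Real.rpow_natCast]
  ring

/-- For a negative first exponent s one has |s| = -s, and the second condition becomes (1 + δ)·2M ≥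
(1 + ρ)N + L - μ. With 2M near that threshold, s behaves like -N(ρ - δ)/(1 + δ), which tends to -∞
exactly because δ < ρ. -/
theorem exists_order_taylorRem (hδ0 : 0 ≤ δ) (hδρ : δ < ρ) (μ S L : ℝ) (hS : 0 ≤ S) (hL : 0 ≤ L) :
    ∃ N₀ : ℕ, ∀ N : ℕ, N₀ ≤ N → ∃ M : ℕ, μ - ρ * N + δ * (2 * M : ℕ) ≤ -S ∧
      N - ((2 * M : ℕ) : ℝ) + |μ - ρ * N + δ * (2 * M : ℕ)| ≤ -L := by
  obtain ⟨N₀, hN₀⟩ := exists_nat_ge (((1 + δ) * (|μ| + S + 2 * δ) + δ * (L + |μ|)) / (ρ - δ))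
  refine ⟨N₀, fun N hN => ?_⟩
  have hN' : ((1 + δ) * (|μ| + S + 2 * δ) + δ * (L + |μ|)) ≤ N * (ρ - δ) := by
    rw [← div_le_iff₀ (sub_pos.2 hδρ)]
    exact hN₀.trans (by exact_mod_cast hN)
  have hμ := le_abs_self μ
  have hμ' := neg_abs_le μ
  -- The threshold for 2M, with -μ replaced by |μ| to keep A nonnegative. Rounding up to an even
  -- integer overshoots by at most 2, which the term 2δ in the choice of N₀ covers.
  set A := ((1 + ρ) * N + L + |μ|) / (1 + δ) with hA
  have hδ1 : 0 < 1 + δ := by linarith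
  have hA1 : (1 + δ) * A = (1 + ρ) * N + L + |μ| := by
    rw [hA]
    field_simp
  have hA0 : 0 ≤ A := by
    have : 0 ≤ ρ := by linarith
    positivity
  refine ⟨⌈A / 2⌉₊, ?_⟩
  have h1 := Nat.le_ceil (A / 2)
  have h2 := Nat.ceil_lt_add_one (a := A / 2) (by positivity)
  push_cast
  set x : ℝ := 2 * (⌈A / 2⌉₊ : ℝ) with hx
  have hx1 : A ≤ x := by linarith
  have hx2 : x ≤ A + 2 := by linarith
  have hs : μ - ρ * N + δ * x ≤ -S := by
    have h3 : δ * x ≤ δ * (A + 2) := mul_le_mul_of_nonneg_left hx2 hδ0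
    have h4 : (1 + δ) * (μ - ρ * N + δ * (A + 2) + S) ≤ 0 := by
      have : (1 + δ) * (μ - ρ * N + δ * (A + 2) + S) =
          (1 + δ) * (μ + S + 2 * δ) - (1 + δ) * ρ * N + δ * ((1 + δ) * A) := by ring
      rw [this, hA1]
      have : (1 + δ) * μ ≤ (1 + δ) * |μ| := mul_le_mul_of_nonneg_left hμ hδ1.le
      linarith
    have h5 := nonpos_of_mul_nonpos_right h4 hδ1
    linarith
  refine ⟨hs, ?_⟩
  rw [abs_of_nonpos (by linarith)]
  have h3 : (1 + δ) * A ≤ (1 + δ) * x := mul_le_mul_of_nonneg_left hx1 hδ1.le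
  linarith

theorem SymSeq.taylorRem_decay (h0 : 0 < ħ) (hδ0 : 0 ≤ δ) (hδρ : δ < ρ) (h : SymSeq ħ μ ρ δ c)
    {S L : ℝ} (hS : 0 ≤ S) (hL : 0 ≤ L) :
    ∃ N₀ : ℕ, ∀ N : ℕ, N₀ ≤ N → ∃ C : ℝ, ∀ k m,
      ‖taylorRem ħ c N k m‖ ≤ C * wt ħ k ^ (-S) * wt ħ m ^ (-L) := by
  obtain ⟨N₀, hN₀⟩ := exists_order_taylorRem hδ0 hδρ μ S L hS hL
  refine ⟨N₀, fun N hN => ?_⟩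
  obtain ⟨M, h1, h2⟩ := hN₀ N hN
  obtain ⟨C, hC, hb⟩ := h.norm_taylorRem_le h0 N M
  refine ⟨C, fun k m => (hb k m).trans ?_⟩
  exact mul_le_mul (mul_le_mul_of_nonneg_left (wt_rpow_mono k h1) hC) (wt_rpow_mono m h2)
    (wt_rpow_pos m _).le (mul_nonneg hC (wt_rpow_pos k _).le)

/-- Differences need no gain here, since S is at one's disposal: a unit shift only changes the
weight by a bounded factor. -/
theorem mdiff_decay {S L : ℝ} (α : Fin n → ℕ)
    (h : ∃ C : ℝ, ∀ k m, ‖c k m‖ ≤ C * wt ħ k ^ (-S) * wt ħ m ^ (-L)) :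
    ∃ C : ℝ, ∀ k m, ‖mdiff ħ α c k m‖ ≤ C * wt ħ k ^ (-S) * wt ħ m ^ (-L) := by
  -- The relation ignores its second argument, so the principle serves as plain invariance under
  -- each Δ_j.
  refine mdiff_induction (ħ := ħ) (E' := (Fin n → ℤ) → ℂ) (R := fun (c : (Fin n → ℤ) → (Fin n → ℤ) → ℂ) _ =>
    ∃ C : ℝ, ∀ k m,
    ‖c k m‖ ≤ C * wt ħ k ^ (-S) * wt ħ m ^ (-L)) ?_ α (h := c) h
  rintro j g _ ⟨C, hC⟩
  have hC0 : 0 ≤ C := by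
    have := (norm_nonneg _).trans (hC 0 0)
    exact nonneg_of_mul_nonneg_left (nonneg_of_mul_nonneg_left this (wt_rpow_pos _ _))
      (wt_rpow_pos _ _)
  refine ⟨|ħ⁻¹| * (C * wt ħ (Pi.single j 1 : Fin n → ℤ) ^ |(-S)| + C), fun k m => ?_⟩
  rw [diff, Pi.smul_apply, norm_smul, Real.norm_eq_abs, mul_assoc, mul_assoc]
  refine mul_le_mul_of_nonneg_left ((norm_sub_le _ _).trans ?_) (abs_nonneg _)
  rw [add_mul]
  refine add_le_add ((hC _ m).trans ?_) ((hC k m).trans_eq (by ring))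
  have := mul_le_mul_of_nonneg_right (mul_le_mul_of_nonneg_left
    (wt_add_rpow_le (ħ := ħ) k (Pi.single j 1) (-S)) hC0) (wt_rpow_pos (ħ := ħ) m (-L)).le
  exact this.trans_eq (by ring)

theorem SymSeq.taylor_term (h0 : 0 < ħ) (h : SymSeq ħ μ ρ δ c) {d : ℕ} {α : Fin n → ℕ}
    (hα : α ∈ Finset.piAntidiag Finset.univ d) :
    SymSeq ħ (μ - d * (ρ - δ)) ρ δ fun k m =>
      taylorCoeff ħ α m * mdiff ħ α (fun l => c l m) k := by
  have h1 := h.poly_mul_mdiff h0 α (isPoly_taylorCoeff (ħ := ħ) α)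
  rw [(Finset.mem_piAntidiag.1 hα).1] at h1
  simp only [mdiff_apply] at h1
  convert h1 using 1
  ring

/-- Rapid decay of c(k + m, m) in m is not immediate, as the first argument moves too; it follows
from the decay of a high-order remainder with S = 0. -/
theorem SymSeq.taylorRem_rapid (h0 : 0 < ħ) (hδ0 : 0 ≤ δ) (hδρ : δ < ρ) (h : SymSeq ħ μ ρ δ c)
    (N : ℕ) (k : Fin n → ℤ) : Rapid ħ (taylorRem ħ c N k) := by
  have ht : ∀ N, Rapid ħ fun m => taylor ħ N (fun l => c l m) k m := fun N =>
    Rapid.sum _ fun d _ => Rapid.sum _ fun α hα => (h.taylor_term h0 hα).rapid k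
  have h1 : Rapid ħ fun m => c (k + m) m := by
    intro L
    obtain ⟨N₀, hN₀⟩ := h.taylorRem_decay h0 hδ0 hδρ le_rfl (Nat.cast_nonneg (α := ℝ) L)
    obtain ⟨C, hC⟩ := hN₀ N₀ le_rfl
    obtain ⟨D, hD⟩ := ht N₀ L
    refine ⟨C + D, fun m => ?_⟩
    have h2 := hC k m
    simp only [neg_zero, Real.rpow_zero, mul_one] at h2
    rw [add_mul]
    calc ‖c (k + m) m‖ = ‖taylorRem ħ c N₀ k m + taylor ħ N₀ (fun l => c l m) k m‖ := by
          simp [taylorRem]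
      _ ≤ _ := (norm_add_le _ _).trans (add_le_add h2 (hD m))
  exact h1.sub (ht N)

/-- The order-N remainder is a high-order one plus the Taylor terms of orders from N on, each of
order at most μ - N(ρ - δ). The high-order part decays so fast that it is estimated by absolute
summation over m. -/
theorem SymSeq.taylorRem (h0 : 0 < ħ) (hδ0 : 0 ≤ δ) (hδρ : δ < ρ) (h : SymSeq ħ μ ρ δ c)
    (N : ℕ) : SymSeq ħ (μ - N * (ρ - δ)) ρ δ (taylorRem ħ c N) := by
  refine ⟨h.taylorRem_rapid h0 hδ0 hδρ N, fun α d p hp => ?_⟩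
  set e := μ - N * (ρ - δ) - ρ * ((∑ j, α j : ℕ) : ℝ) + δ * d with he
  -- S = |e| beats the target exponent e whatever its sign; of L, d powers pay for the polynomial p
  -- and n + 1 for summability over m.
  obtain ⟨N₀, hN₀⟩ := h.taylorRem_decay h0 hδ0 hδρ (abs_nonneg e)
    (Nat.cast_nonneg (α := ℝ) (d + (n + 1)))
  obtain ⟨C, hC⟩ := mdiff_decay α (hN₀ (max N N₀) (le_max_right _ _))
  obtain ⟨A, hA, hpA⟩ := hp.exists_bound h0
  have hq : SymSeq ħ (μ - N * (ρ - δ)) ρ δ fun k m => ∑ d ∈ Finset.Ico N (max N N₀),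
      ∑ α ∈ Finset.piAntidiag Finset.univ d, taylorCoeff ħ α m * mdiff ħ α (fun l => c l m) k := by
    refine SymSeq.sum h0 _ fun d hd => SymSeq.sum h0 _ fun α hα => (h.taylor_term h0 hα).mono ?_
    have : (N : ℝ) ≤ d := by exact_mod_cast (Finset.mem_Ico.1 hd).1
    nlinarith
  obtain ⟨D, hD⟩ := hq.bound α d p hp
  have hsplit : HLattice.taylorRem ħ c N = fun k => HLattice.taylorRem ħ c (max N N₀) k +
      (fun k m => ∑ d ∈ Finset.Ico N (max N N₀), ∑ α ∈ Finset.piAntidiag Finset.univ d,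
        taylorCoeff ħ α m * mdiff ħ α (fun l => c l m) k) k := by
    funext k m
    simp only [Pi.add_apply, HLattice.taylorRem, taylor]
    rw [Finset.sum_Ico_eq_sub _ (le_max_left N N₀)]
    ring
  refine ⟨A * C * (∑' m : Fin n → ℤ, wt ħ m ^ (-((n + 1 : ℕ) : ℝ))) + D, fun k θ => ?_⟩
  rw [hsplit, mdiff_add]
  simp only [Pi.add_apply, mul_add]
  rw [synth_add h0 ((mdiff_rapid h0 α (h.taylorRem_rapid h0 hδ0 hδρ _) k).poly_mul h0 hp)
    ((mdiff_rapid h0 α hq.rapid k).poly_mul h0 hp), add_mul]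
  refine (norm_add_le _ _).trans (add_le_add ?_ (hD k θ))
  have hbd : ∀ m, ‖p m * mdiff ħ α (HLattice.taylorRem ħ c (max N N₀)) k m *
      UnitAddTorus.mFourier m θ‖ ≤
      A * C * wt ħ k ^ (-|e|) * wt ħ m ^ (-((n + 1 : ℕ) : ℝ)) := by
    intro m
    rw [norm_mul, norm_mFourier_apply, mul_one, norm_mul]
    refine (mul_le_mul (hpA m) (hC k m) (norm_nonneg _)
      (mul_nonneg hA (wt_rpow_pos m _).le)).trans_eq ?_
    have : wt ħ m ^ (-((n + 1 : ℕ) : ℝ)) =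
        wt ħ m ^ (d : ℝ) * wt ħ m ^ (-((d + (n + 1) : ℕ) : ℝ)) := by
      rw [← Real.rpow_add (wt_pos m)]
      congr 1
      push_cast
      ring
    rw [this]
    ring
  have hAC : 0 ≤ A * C := by
    have := (norm_nonneg _).trans (hC 0 0)
    exact mul_nonneg hA (nonneg_of_mul_nonneg_left (nonneg_of_mul_nonneg_left this
      (wt_rpow_pos _ _)) (wt_rpow_pos _ _))
  refine (tsum_of_norm_bounded ((summable_wt h0).mul_left _).hasSum hbd).trans ?_
  rw [tsum_mul_left, mul_right_comm]
  refine mul_le_mul_of_nonneg_left (wt_rpow_mono k (neg_abs_le e)) ?_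
  exact mul_nonneg hAC (tsum_nonneg fun m => (wt_rpow_pos m _).le)

theorem taylorRem_zero : taylorRem ħ c 0 = fun k m => c (k + m) m := by
  funext k m
  simp [taylorRem, taylor]

end TaylorRem

/-! ### The symbol of the adjoint -/

/-- The symbol with Fourier coefficients `conj σ̂(k + m, -m)`. -/
def adjointSymbol {n : ℕ} (σ : (Fin n → ℤ) → UnitAddTorus (Fin n) → ℂ) :
    (Fin n → ℤ) → UnitAddTorus (Fin n) → ℂ :=
  fun k => synth fun m => conj (coef (σ (k + m)) (-m))

section AdjointSymbol

variable {n : ℕ} {ħ μ ρ δ : ℝ} {σ : (Fin n → ℤ) → UnitAddTorus (Fin n) → ℂ}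

theorem IsSymbol.symSeq_coef (h0 : 0 < ħ) (hδ0 : 0 ≤ δ) (hσ : IsSymbol ħ μ ρ δ σ) :
    SymSeq ħ μ ρ δ fun k => coef (σ k) := by
  refine IsSymbol.symSeq h0 hδ0 (fun k => (hσ.smooth k).rapid_coef ħ) ?_
  simpa only [(hσ.smooth _).synth_coef] using hσ

/-- The case N = 0 of the remainder estimate, since the remainder of order 0 is c(k + m, m) itself.
-/
theorem IsSymbol.symSeq_adjoint (h0 : 0 < ħ) (hδ0 : 0 ≤ δ) (hδρ : δ < ρ)
    (hσ : IsSymbol ħ μ ρ δ σ) :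
    SymSeq ħ μ ρ δ fun k m => conj (coef (σ (k + m)) (-m)) := by
  have h := ((hσ.symSeq_coef h0 hδ0).conj_neg).taylorRem h0 hδ0 hδρ 0
  simpa [taylorRem_zero] using h

theorem IsSymbol.adjointSymbol (h0 : 0 < ħ) (hδ0 : 0 ≤ δ) (hδρ : δ < ρ)
    (hσ : IsSymbol ħ μ ρ δ σ) : IsSymbol ħ μ ρ δ (adjointSymbol σ) :=
  (hσ.symSeq_adjoint h0 hδ0 hδρ).isSymbol h0

/-- D^(α) acts on conj σ as the multiplier `fallPoly ħ α`, which does not depend on k and so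
commutes with Δ^α: the expansion terms are the Taylor terms. -/
theorem IsSymbol.adjointTerm_eq (h0 : 0 < ħ) (hδ0 : 0 ≤ δ) (hσ : IsSymbol ħ μ ρ δ σ)
    (α : Fin n → ℕ) (k : Fin n → ℤ) : adjointTerm ħ σ α k =
      synth fun m => taylorCoeff ħ α m * mdiff ħ α (fun l => conj (coef (σ l) (-m))) k := by
  have hr := ((hσ.symSeq_coef h0 hδ0).conj_neg).rapid
  have h1 : ∀ l, (fun φ => conj (σ l φ)) = synth fun m => conj (coef (σ l) (-m)) := by
    intro l
    funext φ
    rw [synth_conj_neg, (hσ.smooth l).synth_coef]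
  funext θ
  rw [adjointTerm]
  simp only [h1, mfallingD_synth h0 (hr _)]
  rw [mdiff_synth h0 α fun l => (hr l).poly_mul h0 (isPoly_fallPoly α), ← synth_const_mul]
  congr 1
  funext m
  rw [mdiff_mul_left, mdiff_apply, taylorCoeff, mul_assoc]

theorem IsSymbol.hasAsymptoticExpansion_adjointSymbol (h0 : 0 < ħ) (hδ0 : 0 ≤ δ) (hδρ : δ < ρ)
    (hσ : IsSymbol ħ μ ρ δ σ) :
    HasAsymptoticExpansion ħ μ ρ δ (HLattice.adjointSymbol σ) (adjointTerm ħ σ) := by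
  intro N
  have hc := (hσ.symSeq_coef h0 hδ0).conj_neg
  have h := (hc.taylorRem h0 hδ0 hδρ N).isSymbol h0
  convert h using 1
  funext k θ
  have hterm : ∀ d, ∀ α ∈ Finset.piAntidiag (Finset.univ : Finset (Fin n)) d, Rapid ħ fun m =>
      taylorCoeff ħ α m * mdiff ħ α (fun l => conj (coef (σ l) (-m))) k :=
    fun d α hα => (hc.taylor_term h0 hα).rapid k
  simp only [hσ.adjointTerm_eq h0 hδ0]
  have h2 : ∀ d, synth (fun m => ∑ α ∈ Finset.piAntidiag (Finset.univ : Finset (Fin n)) d,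
      taylorCoeff ħ α m * mdiff ħ α (fun l => conj (coef (σ l) (-m))) k) θ = _ :=
    fun d => synth_sum h0 _ (hterm d) θ
  simp only [← h2]
  rw [← synth_sum h0 _ fun d _ => Rapid.sum _ (hterm d)]
  exact (synth_sub h0 ((hσ.symSeq_adjoint h0 hδ0 hδρ).rapid k)
    (Rapid.sum _ fun d _ => Rapid.sum _ (hterm d)) θ).symm

end AdjointSymbol

/-! ### The operators -/

section Operators

variable {n : ℕ} {ħ μ ρ δ : ℝ} {σ : (Fin n → ℤ) → UnitAddTorus (Fin n) → ℂ}

/-- `Op_ħ(σ)` is the infinite matrix with entries `σ̂(k, j - k)`. -/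
theorem hasSum_opFun (hσ : ∀ k, Continuous (σ k)) (f : L2 n) (k : Fin n → ℤ) :
    HasSum (fun j => f j * coef (σ k) (j - k)) (opFun σ f k) := by
  let G : C(UnitAddTorus (Fin n), ℂ) :=
    ⟨fun θ => conj (UnitAddTorus.mFourier k θ * σ k θ), by have := hσ k; fun_prop⟩
  -- The value of Op(σ)f at k is the inner product of `f̂` with a continuous function, so it can be
  -- evaluated term by term on the series converging in L².
  have h := (innerSL ℂ (ContinuousMap.toLp (E := ℂ) 2 (torusMeasure n) ℂ G)).hasSum
    (summable_fourierL2 f).hasSum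
  have h1 : innerSL ℂ (ContinuousMap.toLp (E := ℂ) 2 (torusMeasure n) ℂ G) (fourierL2 f) =
      opFun σ f k := by
    rw [innerSL_apply_apply, L2.inner_def, opFun]
    refine integral_congr_ae ?_
    filter_upwards [ContinuousMap.coeFn_toLp (p := 2) (𝕜 := ℂ) (torusMeasure n) G] with θ hθ
    rw [hθ, RCLike.inner_apply]
    simp only [G, ContinuousMap.coe_mk, Complex.conj_conj]
    ring
  rw [← h1]
  refine h.congr_fun fun j => ?_
  rw [innerSL_apply_apply, inner_smul_right, ContinuousMap.inner_toLp, coef]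
  congr 1
  refine integral_congr_ae (Filter.Eventually.of_forall fun θ => ?_)
  beta_reduce
  rw [show -(j - k) = -j + k by abel, UnitAddTorus.mFourier_add]
  simp only [G, ContinuousMap.coe_mk, Complex.conj_conj]
  ring

theorem opFun_single (hσ : ∀ k, Continuous (σ k)) (j k : Fin n → ℤ) :
    opFun σ (lp.single 2 j 1) k = coef (σ k) (j - k) := by
  refine (hasSum_opFun hσ _ k).unique ?_
  convert hasSum_single j fun i hi => ?_ using 1
  · simp
  · simp [hi]

theorem coef_adjointSymbol (h0 : 0 < ħ) (hδ0 : 0 ≤ δ) (hδρ : δ < ρ) (hσ : IsSymbol ħ μ ρ δ σ)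
    (j k : Fin n → ℤ) : coef (adjointSymbol σ j) (k - j) = conj (coef (σ k) (j - k)) := by
  rw [adjointSymbol, coef_synth (((hσ.symSeq_adjoint h0 hδ0 hδρ).rapid j).summable_norm h0)]
  simp

theorem hasSum_opFun_adjointSymbol (h0 : 0 < ħ) (hδ0 : 0 ≤ δ) (hδρ : δ < ρ)
    (hσ : IsSymbol ħ μ ρ δ σ) (g : L2 n) (j : Fin n → ℤ) :
    HasSum (fun k => g k * conj (coef (σ k) (j - k))) (opFun (adjointSymbol σ) g j) := by
  simpa only [coef_adjointSymbol h0 hδ0 hδρ hσ] using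
    hasSum_opFun (hσ.adjointSymbol h0 hδ0 hδρ).continuous g j

/-- Pairing g with the j-th column of Op(σ) is applying the j-th row of the conjugate transpose. The
vector u records that the column lies in ℓ². -/
theorem inner_eq_opFun_adjointSymbol (h0 : 0 < ħ) (hδ0 : 0 ≤ δ) (hδρ : δ < ρ)
    (hσ : IsSymbol ħ μ ρ δ σ) {j : Fin n → ℤ} {u : L2 n}
    (hu : ∀ k, u k = opFun σ (lp.single 2 j 1) k) (g : L2 n) :
    inner ℂ u g = opFun (adjointSymbol σ) g j := by
  refine (lp.hasSum_inner u g).unique ?_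
  simpa only [RCLike.inner_apply, hu, opFun_single hσ.continuous] using
    hasSum_opFun_adjointSymbol h0 hδ0 hδρ hσ g j

/-! ### Schwartz sequences: density and mapping into ℓ² -/

theorem single_mem_schwartz (ħ : ℝ) (j : Fin n → ℤ) (a : ℂ) : lp.single 2 j a ∈ schwartz n ħ := by
  intro N
  refine ⟨‖a‖ * wt ħ j ^ (N : ℝ), fun k => ?_⟩
  change _ ≤ _ * wt ħ k ^ (-(N : ℝ))
  rcases eq_or_ne k j with rfl | h
  · rw [lp.single_apply_self, mul_assoc, ← Real.rpow_add (wt_pos k)]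
    simp
  · rw [lp.single_apply_ne _ _ _ h, norm_zero]
    exact mul_nonneg (mul_nonneg (norm_nonneg a) (wt_rpow_pos j _).le) (wt_rpow_pos k _).le

theorem dense_schwartz (n : ℕ) (ħ : ℝ) : Dense (schwartz n ħ : Set (L2 n)) := fun f =>
  mem_closure_of_tendsto (lp.hasSum_single (by norm_num) f)
    (Filter.Eventually.of_forall fun s => Submodule.sum_mem _ fun j _ => single_mem_schwartz ħ j _)

/-- Off-diagonal decay (1 + |j - k|)^{-2M} is turned by Peetre's inequality into decay in k, at the
price of growth in j that the Schwartz function f absorbs. The net exponent of k is μ - 2M(1 - δ),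
arbitrarily negative since δ < 1. -/
theorem IsSymbol.exists_matrix_bound (h0 : 0 < ħ) (hδ0 : 0 ≤ δ) (hδ1 : δ < 1)
    (hσ : IsSymbol ħ μ ρ δ σ) {f : L2 n} (hf : f ∈ schwartz n ħ) :
    ∃ C : ℝ, ∀ k j, ‖f j * coef (σ k) (j - k)‖ ≤
      C * (wt ħ k ^ (-((n + 1 : ℕ) : ℝ)) * wt ħ j ^ (-((n + 1 : ℕ) : ℝ))) := by
  obtain ⟨M, hM⟩ := exists_nat_ge ((μ + (n + 1 : ℕ)) / (2 * (1 - δ)))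
  rw [div_le_iff₀ (by linarith)] at hM
  obtain ⟨C, hC, hb⟩ := (hσ.symSeq_coef h0 hδ0).norm_mdiff_le h0 0 M
  obtain ⟨D, hD⟩ := hf (2 * M + (n + 1))
  refine ⟨D * C, fun k j => ?_⟩
  have h1 := hb 0 (by simp) k (j - k)
  rw [mdiff_zero] at h1
  have h2 := wt_add_rpow_le (ħ := ħ) (-k) j (-((2 * M : ℕ) : ℝ))
  rw [wt_neg, abs_neg, Nat.abs_cast, neg_add_eq_sub] at h2
  have h3 : ‖f j‖ ≤ D * wt ħ j ^ (-((2 * M + (n + 1) : ℕ) : ℝ)) := hD j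
  have hD0 : 0 ≤ D := nonneg_of_mul_nonneg_left ((norm_nonneg _).trans h3) (wt_rpow_pos _ _)
  have h4 : wt ħ k ^ (μ - ρ * (0 : ℕ) + δ * (2 * M : ℕ)) * wt ħ k ^ (-((2 * M : ℕ) : ℝ)) ≤
      wt ħ k ^ (-((n + 1 : ℕ) : ℝ)) := by
    rw [← Real.rpow_add (wt_pos k)]
    refine wt_rpow_mono k ?_
    push_cast at hM ⊢
    linarith
  have h5 : wt ħ j ^ (-((2 * M + (n + 1) : ℕ) : ℝ)) * wt ħ j ^ ((2 * M : ℕ) : ℝ) =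
      wt ħ j ^ (-((n + 1 : ℕ) : ℝ)) := by
    rw [← Real.rpow_add (wt_pos j)]
    congr 1
    push_cast
    ring
  have hk := fun s => (wt_rpow_pos (ħ := ħ) k s).le
  have hj := fun s => (wt_rpow_pos (ħ := ħ) j s).le
  rw [norm_mul]
  calc ‖f j‖ * ‖coef (σ k) (j - k)‖
      ≤ (D * wt ħ j ^ (-((2 * M + (n + 1) : ℕ) : ℝ))) *
        (C * wt ħ k ^ (μ - ρ * (0 : ℕ) + δ * (2 * M : ℕ)) *
          (wt ħ k ^ (-((2 * M : ℕ) : ℝ)) * wt ħ j ^ ((2 * M : ℕ) : ℝ))) :=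
        mul_le_mul h3 (h1.trans (mul_le_mul_of_nonneg_left h2 (mul_nonneg hC (hk _))))
          (norm_nonneg _) (mul_nonneg hD0 (hj _))
    _ = D * C * ((wt ħ k ^ (μ - ρ * (0 : ℕ) + δ * (2 * M : ℕ)) * wt ħ k ^ (-((2 * M : ℕ) : ℝ))) *
          (wt ħ j ^ (-((2 * M + (n + 1) : ℕ) : ℝ)) * wt ħ j ^ ((2 * M : ℕ) : ℝ))) := by ring
    _ ≤ _ := by
        rw [h5]
        exact mul_le_mul_of_nonneg_left (mul_le_mul_of_nonneg_right h4 (hj _)) (mul_nonneg hD0 hC)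

theorem IsSymbol.schwartz_le_domain (h0 : 0 < ħ) (hδ0 : 0 ≤ δ) (hδ1 : δ < 1)
    (hσ : IsSymbol ħ μ ρ δ σ) : schwartz n ħ ≤ (opMax σ hσ.continuous).domain := by
  intro f hf
  change Memℓp (opFun σ f) 2
  obtain ⟨C, hC⟩ := hσ.exists_matrix_bound h0 hδ0 hδ1 hf
  -- The matrix bound is summable in both indices, so the image even lies in ℓ¹.
  have h1 : Memℓp (opFun σ f) 1 := by
    refine memℓp_gen ?_
    simp only [ENNReal.toReal_one, Real.rpow_one]
    refine Summable.of_nonneg_of_le (fun _ => norm_nonneg _) (fun k => ?_)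
      ((summable_wt h0).mul_left (C * ∑' j : Fin n → ℤ, wt ħ j ^ (-((n + 1 : ℕ) : ℝ))))
    rw [← (hasSum_opFun hσ.continuous f k).tsum_eq]
    refine (tsum_of_norm_bounded
      (((summable_wt h0).mul_left _).mul_left _).hasSum (hC k)).trans_eq ?_
    rw [tsum_mul_left, tsum_mul_left]
    ring
  exact h1.of_exponent_ge (by norm_num)

/-! ### The Hilbert space adjoint -/

theorem IsSymbol.isFormalAdjoint (h0 : 0 < ħ) (hδ0 : 0 ≤ δ) (hδρ : δ < ρ) (hρ1 : ρ ≤ 1)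
    (hσ : IsSymbol ħ μ ρ δ σ) : (opSchwartz ħ σ hσ.continuous).IsFormalAdjoint
      (opMax (HLattice.adjointSymbol σ) (hσ.adjointSymbol h0 hδ0 hδρ).continuous) := by
  rintro ⟨f, hf⟩ ⟨g, hg⟩
  have hf' : f ∈ schwartz n ħ := hf.1
  obtain ⟨C, hC⟩ := hσ.exists_matrix_bound h0 hδ0 (hδρ.trans_le hρ1) hf'
  -- Absolute convergence of the double series, with g merely bounded by its ℓ² norm; this licenses
  -- the interchange of the sums over k and j.
  have hsum : Summable (Function.uncurry fun k j : Fin n → ℤ =>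
      g k * conj (f j * coef (σ k) (j - k))) := by
    have h1 := ((summable_wt (n := n) h0).mul_of_nonneg (summable_wt (n := n) h0)
      (fun k => (wt_rpow_pos k _).le) fun k => (wt_rpow_pos k _).le).mul_left (‖g‖ * C)
    refine h1.of_norm_bounded fun x => ?_
    rw [Function.uncurry, norm_mul, RCLike.norm_conj, mul_assoc]
    exact mul_le_mul (lp.norm_apply_le_norm two_ne_zero g _) (hC _ _) (norm_nonneg _)
      (norm_nonneg _)
  have e1 : inner ℂ (opSchwartz ħ σ hσ.continuous ⟨f, hf⟩) g =
      ∑' k, ∑' j, g k * conj (f j * coef (σ k) (j - k)) := by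
    rw [lp.inner_eq_tsum]
    refine tsum_congr fun k => ?_
    rw [tsum_mul_left, ← Complex.conj_tsum, (hasSum_opFun hσ.continuous f k).tsum_eq,
      RCLike.inner_apply]
    rfl
  have e2 : inner ℂ f (opMax (HLattice.adjointSymbol σ)
      (hσ.adjointSymbol h0 hδ0 hδρ).continuous ⟨g, hg⟩) =
      ∑' j, ∑' k, g k * conj (f j * coef (σ k) (j - k)) := by
    rw [lp.inner_eq_tsum]
    refine tsum_congr fun j => ?_
    have e3 : ∀ k, g k * conj (f j * coef (σ k) (j - k)) =
        conj (f j) * (g k * conj (coef (σ k) (j - k))) := fun k => by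
      rw [map_mul]
      ring
    simp only [e3]
    rw [tsum_mul_left, (hasSum_opFun_adjointSymbol h0 hδ0 hδρ hσ g j).tsum_eq,
      RCLike.inner_apply, mul_comm]
    rfl
  exact e1.trans ((hsum.tsum_comm).symm.trans e2.symm)

theorem IsSymbol.adjoint_opSchwartz (h0 : 0 < ħ) (hδ0 : 0 ≤ δ) (hδρ : δ < ρ) (hρ1 : ρ ≤ 1)
    (hσ : IsSymbol ħ μ ρ δ σ) : (opSchwartz ħ σ hσ.continuous).adjoint =
      opMax (HLattice.adjointSymbol σ) (hσ.adjointSymbol h0 hδ0 hδρ).continuous := by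
  have hdom := hσ.schwartz_le_domain h0 hδ0 (hδρ.trans_le hρ1)
  have hmem : ∀ f ∈ schwartz n ħ, f ∈ (opSchwartz ħ σ hσ.continuous).domain :=
    fun f hf => ⟨hf, hdom hf⟩
  have hT : Dense ((opSchwartz ħ σ hσ.continuous).domain : Set (L2 n)) :=
    (dense_schwartz n ħ).mono hmem
  have hle := (hσ.isFormalAdjoint h0 hδ0 hδρ hρ1).le_adjoint hT
  refine (LinearPMap.eq_of_le_of_domain_eq hle (le_antisymm hle.1 fun g hg => ?_)).symm
  change Memℓp (opFun (HLattice.adjointSymbol σ) g) 2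
  -- Formal adjointness gives only one inclusion. For the other, pairing with the j-th basis vector,
  -- which is Schwartz, computes the j-th coordinate of the adjoint; hence the image under Op of the
  -- adjoint symbol is an ℓ² sequence.
  have key : ∀ j, (opSchwartz ħ σ hσ.continuous).adjoint ⟨g, hg⟩ j =
      opFun (HLattice.adjointSymbol σ) g j := by
    intro j
    have h1 := LinearPMap.adjoint_isFormalAdjoint hT ⟨g, hg⟩
      ⟨lp.single 2 j 1, hmem _ (single_mem_schwartz ħ j 1)⟩
    rw [lp.inner_single_right, ← inner_conj_symm g,
      inner_eq_opFun_adjointSymbol h0 hδ0 hδρ hσ (j := j) fun k => rfl] at h1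
    simpa using congrArg conj h1
  rw [← funext key]
  exact lp.memℓp _

theorem IsSymbol.adjoint_of_bounded (h0 : 0 < ħ) (hδ0 : 0 ≤ δ) (hδρ : δ < ρ)
    (hσ : IsSymbol ħ μ ρ δ σ) (A : L2 n →L[ℂ] L2 n) (hA : ∀ f k, A f k = opFun σ f k)
    (g : L2 n) (k : Fin n → ℤ) :
    ContinuousLinearMap.adjoint A g k = opFun (HLattice.adjointSymbol σ) g k := by
  rw [← inner_eq_opFun_adjointSymbol h0 hδ0 hδρ hσ (hA (lp.single 2 k 1)) g,
    ← ContinuousLinearMap.adjoint_inner_right, lp.inner_single_left]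
  simp

end Operators

end HLattice

end

theorem mainTheorem3 (n : ℕ) (ħ μ ρ δ : ℝ) (hħ0 : 0 < ħ) (hħ1 : ħ ≤ 1)
    (hδ0 : 0 ≤ δ) (hδρ : δ < ρ) (hρ1 : ρ ≤ 1)
    (σ : (Fin n → ℤ) → UnitAddTorus (Fin n) → ℂ) (hσ : HLattice.IsSymbol ħ μ ρ δ σ) :
    ∃ (τ : (Fin n → ℤ) → UnitAddTorus (Fin n) → ℂ) (hτ : HLattice.IsSymbol ħ μ ρ δ τ),
      -- `Op(σ)` and `Op(τ)` map the Schwartz space, which is dense, into `ℓ²`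
      Dense (HLattice.schwartz n ħ : Set (HLattice.L2 n)) ∧
      HLattice.schwartz n ħ ≤ (HLattice.opMax σ hσ.continuous).domain ∧
      HLattice.schwartz n ħ ≤ (HLattice.opMax τ hτ.continuous).domain ∧
      -- the Hilbert space adjoint of `Op(σ)`, given on the Schwartz space, is `Op(τ)`
      (HLattice.opSchwartz ħ σ hσ.continuous).adjoint = HLattice.opMax τ hτ.continuous ∧
      -- if `Op(σ)` is a bounded operator on `ℓ²`, then `Op(τ)` is its adjoint on all of `ℓ²`
      (∀ A : HLattice.L2 n →L[ℂ] HLattice.L2 n,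
        (∀ f k, A f k = HLattice.opFun σ f k) →
          ∀ g k, ContinuousLinearMap.adjoint A g k = HLattice.opFun τ g k) ∧
      -- the asymptotic expansion of the symbol of the adjoint
      HLattice.HasAsymptoticExpansion ħ μ ρ δ τ (HLattice.adjointTerm ħ σ) := by
  have hδ1 := hδρ.trans_le hρ1
  have hτ := hσ.adjointSymbol hħ0 hδ0 hδρ
  exact ⟨HLattice.adjointSymbol σ, hτ, HLattice.dense_schwartz n ħ,
    hσ.schwartz_le_domain hħ0 hδ0 hδ1, hτ.schwartz_le_domain hħ0 hδ0 hδ1,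
    hσ.adjoint_opSchwartz hħ0 hδ0 hδρ hρ1, hσ.adjoint_of_bounded hħ0 hδ0 hδρ,
    hσ.hasAsymptoticExpansion_adjointSymbol hħ0 hδ0 hδρ⟩
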